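/- \textbf{Notation.} Let $s=\{\xi\in\mathbb C^{\mathbb N}: |\xi|_q=(\sum_j|\xi_j|^2j^{2q})^{1/2}<\infty \text{ for all } q\in\mathbb N_0\}$ with the topology of the norms $|\cdot|_q$, and let $s'=\{\xi\in\mathbb C^{\mathbb N}: |\xi|'_q=(\sum_j|\xi_j|^2j^{-2q})^{1/2}<\infty\text{ for some }q\in\mathbb N_0\}$ with the inductive limit topology. Let $L(s',s)$ be the space of continuous linear operators $s'\to s$ with the topology of the norms $\|x\|_q=\sup_{|\xi|'_q\le1}|x\xi|_q$, $q\in\mathbb N_0$, with multiplication $xy=x\circ j\circ y$ (where $j:s\hookrightarrow s'$ is the inclusion) and with the involution $x\mapsto x^*$ inherited from $L(\ell_2)$ via the canonical embedding $L(s',s)\hookrightarrow L(\ell_2)$ given by $\ell_2\hookrightarrow s'\to s\hookrightarrow \ell_2$. A projection in $L(s',s)$ is an element whose image in $L(\ell_2)$ is an orthogonal projection. For $Z\subseteq L(s',s)$, $\operatorname{alg}(Z)$ is the smallest closed $*$-subalgebra of $L(s',s)$ containing $Z$. For a matrix $(a_{n,q})$, $\lambda^1(a_{n,q})$ and $\lambda^\infty(a_{n,q})$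 are the spaces of complex sequences $\xi$ with $\sum_n|\xi_n|a_{n,q}<\infty$, respectively $\sup_n|\xi_n|a_{n,q}<\infty$, for all $q\in\mathbb N_0$, with the topology given by these expressions as norms. \textbf{Theorem.} Let $A$ be a closed, commutative, infinite-dimensional $*$-subalgebra of $L(s',s)$. Let $\mathcal M$ be the set of minimal elements of the set of nonzero projections belonging to $A$, ordered by $Q\preceq P\iff QP=PQ=Q$. Then $\mathcal M$ is countably infinite, and for every enumeration $(P_n)_{n\in\mathbb N}$ of $\mathcal M$ without repetitions: \begin{enumerate} \item the $P_n$ are pairwise orthogonal and finite dimensional, and $(P_n)_{n\in\mathbb N}$ is a Schauder basis of $A$; \item $A=\operatorname{alg}(\{P_n\}_{n\in\mathbb N})$; \item there is a linear homeomorphism of $A$ onto $\lambda^1(\|P_n\|_q)$ which sends $P_n$ to the $n$-th unit sequence and carries the multiplication and the involution of $A$ to the pointwise multiplication and the pointwise complex conjugation; moreover, $\lambda^1(\|P_n\|_q)=\lambda^\infty(\|P_n\|_q)$ as sets and as topological vector spaces. Thus $A\cong\lambda^1(\|P_n\|_q)=\lambda^\infty(\|P_n\|_q)$ as Fréchet $*$-algebras;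 \item there are an operator $x\in A$ and a sequence $(\lambda_n)_{n\in\mathbb N}\in s$ of nonzero, pairwise different complex numbers with $|\lambda_1|\ge|\lambda_2|\ge\dots$ such that $x=\sum_{n=1}^\infty\lambda_nP_n$, the series converging absolutely in $L(s',s)$ (so that this is the spectral representation of $x$), and $A=\operatorname{alg}(x)$. \end{enumerate} -/

import Mathlib

open Filter Topology
open scoped ENNReal

noncomputable section

namespace SmoothOperators

/-! ### Köthe spaces

Sequences are indexed by `ℕ = {0, 1, 2, …}`; the index `j` stands for the `(j+1)`-st term, so the
weight usually written `j ^ q`, `j ≥ 1`, becomes `(j + 1) ^ q`. -/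

/-- The underlying vector space of `λ^p(a_{j,q})`: all `ξ` with `(ξ_j a_{j,q})_j ∈ ℓ^p` for all
`q`. -/
def koethe (p : ℝ≥0∞) (a : ℕ → ℕ → ℝ) : Submodule ℂ (ℕ → ℂ) where
  carrier := {ξ | ∀ q, Memℓp (fun j => (a j q : ℂ) * ξ j) p}
  zero_mem' q := by
    convert (zero_memℓp : Memℓp (0 : ℕ → ℂ) p) using 1
    funext j
    simp
  add_mem' {ξ η} hξ hη q := by
    have h := (hξ q).add (hη q)
    convert h using 1
    funext j
    simp [mul_add]
  smul_mem' c ξ hξ q := by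
    have h := (hξ q).const_smul c
    convert h using 1
    funext j
    simp [mul_left_comm]

/-- The Köthe space `λ^p(a_{j,q})`; its topology (defined below) is not the one induced
from `ℕ → ℂ`. -/
def KoetheSpace (p : ℝ≥0∞) (a : ℕ → ℕ → ℝ) : Type := ↥(koethe p a)

namespace KoetheSpace

variable (p : ℝ≥0∞) (a : ℕ → ℕ → ℝ)

instance : AddCommGroup (KoetheSpace p a) := inferInstanceAs (AddCommGroup ↥(koethe p a))
instance : Module ℂ (KoetheSpace p a) := inferInstanceAs (Module ℂ ↥(koethe p a))
instance : FunLike (KoetheSpace p a) ℕ ℂ := ⟨fun ξ => ξ.1, Subtype.val_injective⟩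

variable {p a} in
@[ext] theorem ext {ξ η : KoetheSpace p a} (h : ∀ j, ξ j = η j) : ξ = η :=
  Subtype.ext (funext h)

variable {p a} in
@[simp] theorem add_apply (ξ η : KoetheSpace p a) (j : ℕ) : (ξ + η) j = ξ j + η j := rfl

variable {p a} in
@[simp] theorem smul_apply (c : ℂ) (ξ : KoetheSpace p a) (j : ℕ) : (c • ξ) j = c * ξ j := rfl

/-- `ξ ↦ (a_{j,q} ξ_j)_j`, from `λ^p(a)` to `ℓ^p`. -/
def weight (q : ℕ) : KoetheSpace p a →ₗ[ℂ] lp (fun _ : ℕ => ℂ) p where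
  toFun ξ := ⟨fun j => (a j q : ℂ) * ξ j, ξ.2 q⟩
  map_add' ξ η := by
    apply lp.ext; funext j
    exact mul_add _ _ _
  map_smul' c ξ := by
    apply lp.ext; funext j
    exact mul_left_comm _ _ _

@[simp] theorem weight_apply (q : ℕ) (ξ : KoetheSpace p a) (j : ℕ) :
    weight p a q ξ j = (a j q : ℂ) * ξ j := rfl

variable [Fact (1 ≤ p)]

/-- `|ξ|_{p,q} = ‖(a_{j,q} ξ_j)_j‖_{ℓ^p}`. -/
def seminorm : SeminormFamily ℂ (KoetheSpace p a) ℕ :=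
  fun q => (normSeminorm ℂ (lp (fun _ : ℕ => ℂ) p)).comp (weight p a q)

theorem seminorm_apply (q : ℕ) (ξ : KoetheSpace p a) :
    seminorm p a q ξ = ‖weight p a q ξ‖ := rfl

/-- The Köthe topology, given by the system `(|·|_{p,q})_q`. -/
instance : TopologicalSpace (KoetheSpace p a) := (seminorm p a).moduleFilterBasis.topology

theorem withSeminorms : WithSeminorms (seminorm p a) := ⟨rfl⟩

instance : IsTopologicalAddGroup (KoetheSpace p a) := (withSeminorms p a).topologicalAddGroup
instance : ContinuousSMul ℂ (KoetheSpace p a) := (withSeminorms p a).continuousSMul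

/-- `weight` as a continuous linear map. -/
def weightL (q : ℕ) : KoetheSpace p a →L[ℂ] lp (fun _ : ℕ => ℂ) p where
  toLinearMap := weight p a q
  cont := by
    refine WithSeminorms.continuous_of_isBounded (withSeminorms p a)
      (norm_withSeminorms ℂ (lp (fun _ : ℕ => ℂ) p)) _ ?_
    intro _
    exact ⟨{q}, 1, by simp [seminorm]⟩

end KoetheSpace

/-! ### The spaces `s`, `s'` and `ℓ₂` -/

/-- The weight `(j + 1) ^ q`. -/
def wt (j q : ℕ) : ℝ := ((j : ℝ) + 1) ^ q

theorem wt_pos (j q : ℕ) : 0 < wt j q := by unfold wt; positivity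

theorem wt_ne (j q : ℕ) : ((wt j q : ℝ) : ℂ) ≠ 0 := by exact_mod_cast (wt_pos j q).ne'

@[simp] theorem wt_zero (j : ℕ) : wt j 0 = 1 := by simp [wt]

theorem wt_mono (j : ℕ) {p q : ℕ} (h : p ≤ q) : wt j p ≤ wt j q :=
  pow_le_pow_right₀ (by linarith [Nat.cast_nonneg (α := ℝ) j]) h

/-- The Hilbert space `ℓ₂`. -/
abbrev Ell2 : Type := lp (fun _ : ℕ => ℂ) 2

/-- The space `s` of rapidly decreasing sequences, with the norms
`|ξ|_q = (∑ |ξ_j|² (j+1)^{2q})^{1/2}`. -/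
abbrev RapidSeq : Type := KoetheSpace 2 wt

theorem memℓp_slow_mono {η : ℕ → ℂ} {p q : ℕ} (hpq : p ≤ q)
    (h : Memℓp (fun j => (((wt j p)⁻¹ : ℝ) : ℂ) * η j) 2) :
    Memℓp (fun j => (((wt j q)⁻¹ : ℝ) : ℂ) * η j) 2 := by
  refine h.mono' (fun j => ?_)
  simp only [norm_mul, Complex.norm_real, Real.norm_eq_abs, abs_inv, abs_of_pos (wt_pos _ _)]
  gcongr
  · exact wt_pos _ _
  · exact wt_mono j hpq

/-- The underlying vector space of `s'`: all `η` with
`|η|'_q = (∑ |η_j|² (j+1)^{-2q})^{1/2} < ∞` for some `q`. -/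
def slow : Submodule ℂ (ℕ → ℂ) where
  carrier := {η | ∃ q : ℕ, Memℓp (fun j => (((wt j q)⁻¹ : ℝ) : ℂ) * η j) 2}
  zero_mem' := ⟨0, by
    convert (zero_memℓp : Memℓp (0 : ℕ → ℂ) 2) using 1
    funext j
    simp⟩
  add_mem' {ξ η} := by
    rintro ⟨p, hp⟩ ⟨q, hq⟩
    refine ⟨max p q, ?_⟩
    have h := (memℓp_slow_mono (le_max_left p q) hp).add (memℓp_slow_mono (le_max_right p q) hq)
    convert h using 1
    funext j
    simp [mul_add]
  smul_mem' c ξ := by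
    rintro ⟨q, hq⟩
    refine ⟨q, ?_⟩
    have h := hq.const_smul c
    convert h using 1
    funext j
    simp [mul_left_comm]

/-- The space `s'` of slowly increasing sequences; its topology is the inductive limit topology
defined below. -/
def SlowSeq : Type := ↥slow

namespace SlowSeq

instance : AddCommGroup SlowSeq := inferInstanceAs (AddCommGroup ↥slow)
instance : Module ℂ SlowSeq := inferInstanceAs (Module ℂ ↥slow)
instance : FunLike SlowSeq ℕ ℂ := ⟨fun ξ => ξ.1, Subtype.val_injective⟩

@[ext] theorem ext {ξ η : SlowSeq} (h : ∀ j, ξ j = η j) : ξ = η := Subtype.ext (funext h)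

@[simp] theorem add_apply (ξ η : SlowSeq) (j : ℕ) : (ξ + η) j = ξ j + η j := rfl

@[simp] theorem smul_apply (c : ℂ) (ξ : SlowSeq) (j : ℕ) : (c • ξ) j = c * ξ j := rfl

theorem memℓp_wt_mul (q : ℕ) (v : Ell2) :
    Memℓp (fun j => (((wt j q)⁻¹ : ℝ) : ℂ) * ((wt j q : ℂ) * v j)) 2 := by
  convert lp.memℓp v using 1
  funext j
  rw [Complex.ofReal_inv, inv_mul_cancel_left₀ (wt_ne j q)]

/-- `v ↦ ((j+1)^q v_j)_j`. This is an isometry of `ℓ₂` onto the step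
`{η : |η|'_q < ∞}` with the norm `|·|'_q`. -/
def step (q : ℕ) : Ell2 →ₗ[ℂ] SlowSeq where
  toFun v := ⟨fun j => (wt j q : ℂ) * v j, q, memℓp_wt_mul q v⟩
  map_add' v w := by ext j; exact mul_add _ _ _
  map_smul' c v := by ext j; exact mul_left_comm _ _ _

@[simp] theorem step_apply (q : ℕ) (v : Ell2) (j : ℕ) : step q v j = (wt j q : ℂ) * v j := rfl

/-- The seminorms on `s'` that are continuous on every step `({η : |η|'_q < ∞}, |·|'_q)`. -/
def IndSeminorm : Type := {P : Seminorm ℂ SlowSeq // ∀ q, ∃ C : ℝ, ∀ v, P (step q v) ≤ C * ‖v‖}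

instance : Nonempty IndSeminorm := ⟨⟨0, fun _ => ⟨0, fun _ => by simp⟩⟩⟩

/-- The family of all seminorms on `s'` whose restrictions to the steps are continuous. -/
def seminorm : SeminormFamily ℂ SlowSeq IndSeminorm := fun P => P.1

/-- The (locally convex) inductive limit topology on `s'`. -/
instance : TopologicalSpace SlowSeq := seminorm.moduleFilterBasis.topology

theorem withSeminorms : WithSeminorms seminorm := ⟨rfl⟩

instance : IsTopologicalAddGroup SlowSeq := withSeminorms.topologicalAddGroup
instance : ContinuousSMul ℂ SlowSeq := withSeminorms.continuousSMul

/-- `step` as a continuous linear map. -/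
def stepL (q : ℕ) : Ell2 →L[ℂ] SlowSeq where
  toLinearMap := step q
  cont := by
    refine WithSeminorms.continuous_of_isBounded (norm_withSeminorms ℂ Ell2) withSeminorms _ ?_
    rintro ⟨P, hP⟩
    obtain ⟨C, hC⟩ := hP q
    refine ⟨{0}, C.toNNReal, fun v => ?_⟩
    refine (hC v).trans ?_
    simp only [Finset.sup_singleton]
    exact mul_le_mul_of_nonneg_right (Real.le_coe_toNNReal C) (norm_nonneg v)

@[simp] theorem stepL_apply (q : ℕ) (v : Ell2) (j : ℕ) : stepL q v j = (wt j q : ℂ) * v j := rfl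

theorem exists_stepL (η : SlowSeq) : ∃ q, ∀ r, q ≤ r → ∃ v, stepL r v = η := by
  obtain ⟨f, q, hq⟩ := η
  refine ⟨q, fun r hr => ⟨⟨_, memℓp_slow_mono hr hq⟩, ?_⟩⟩
  ext j
  change (wt j r : ℂ) * ((((wt j r)⁻¹ : ℝ) : ℂ) * f j) = f j
  rw [Complex.ofReal_inv, mul_inv_cancel_left₀ (wt_ne j r)]

end SlowSeq

/-- The canonical inclusion `s ↪ s'` (through `ℓ₂`). -/
def incl : RapidSeq →L[ℂ] SlowSeq := (SlowSeq.stepL 0).comp (KoetheSpace.weightL 2 wt 0)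

@[simp] theorem incl_apply (ξ : RapidSeq) (j : ℕ) : incl ξ j = ξ j := by
  change (wt j 0 : ℂ) * ((wt j 0 : ℂ) * ξ j) = ξ j
  simp

/-! ### The algebra `L(s', s)` -/

/-- The space `L(s', s)` of continuous linear operators from `s'` to `s`. -/
def SmoothOp : Type := SlowSeq →L[ℂ] RapidSeq

namespace SmoothOp

instance : AddCommGroup SmoothOp := inferInstanceAs (AddCommGroup (SlowSeq →L[ℂ] RapidSeq))
instance : Module ℂ SmoothOp := inferInstanceAs (Module ℂ (SlowSeq →L[ℂ] RapidSeq))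
instance : FunLike SmoothOp SlowSeq RapidSeq :=
  inferInstanceAs (FunLike (SlowSeq →L[ℂ] RapidSeq) SlowSeq RapidSeq)
instance : ContinuousLinearMapClass SmoothOp ℂ SlowSeq RapidSeq :=
  inferInstanceAs (ContinuousLinearMapClass (SlowSeq →L[ℂ] RapidSeq) ℂ SlowSeq RapidSeq)

/-- `x · y = x ∘ j ∘ y` with the inclusion `j : s ↪ s'`. -/
instance : Mul SmoothOp :=
  ⟨fun x y => ContinuousLinearMap.comp (show SlowSeq →L[ℂ] RapidSeq from x)
    (incl.comp (show SlowSeq →L[ℂ] RapidSeq from y))⟩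

theorem mul_apply (x y : SmoothOp) (ξ : SlowSeq) : (x * y) ξ = x (incl (y ξ)) := rfl

@[ext] theorem ext {x y : SmoothOp} (h : ∀ ξ, x ξ = y ξ) : x = y := ContinuousLinearMap.ext h

@[simp] theorem add_apply (x y : SmoothOp) (ξ : SlowSeq) : (x + y) ξ = x ξ + y ξ := rfl
@[simp] theorem smul_apply (c : ℂ) (x : SmoothOp) (ξ : SlowSeq) : (c • x) ξ = c • x ξ := rfl
@[simp] theorem zero_apply (ξ : SlowSeq) : (0 : SmoothOp) ξ = 0 := rfl

instance : NonUnitalRing SmoothOp :=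
  { (inferInstance : AddCommGroup SmoothOp), (inferInstance : Mul SmoothOp) with
    left_distrib := fun x y z => by
      ext1 ξ; simp only [mul_apply, add_apply, map_add]
    right_distrib := fun x y z => by
      ext1 ξ; simp only [mul_apply, add_apply]
    zero_mul := fun x => by ext1 ξ; simp only [mul_apply, zero_apply]
    mul_zero := fun x => by ext1 ξ; simp only [mul_apply, zero_apply, map_zero]
    mul_assoc := fun x y z => by ext1 ξ; simp only [mul_apply] }

instance : IsScalarTower ℂ SmoothOp SmoothOp :=
  ⟨fun c x y => by ext1 ξ; simp only [smul_eq_mul, mul_apply, smul_apply]⟩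

instance : SMulCommClass ℂ SmoothOp SmoothOp :=
  ⟨fun c x y => by ext1 ξ; simp only [smul_eq_mul, mul_apply, smul_apply, map_smul]⟩

/-- The operator `W_q ∘ x ∘ D_q` on `ℓ₂`, where `D_q v = ((j+1)^q v_j)_j` identifies `ℓ₂` with the
step `{η : |η|'_q < ∞}` of `s'`, and `W_q ξ = ((j+1)^q ξ_j)_j` has `‖W_q ξ‖ = |ξ|_q`. -/
def weighted (q : ℕ) : SmoothOp →ₗ[ℂ] (Ell2 →L[ℂ] Ell2) where
  toFun x := (KoetheSpace.weightL 2 wt q).comp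
    ((show SlowSeq →L[ℂ] RapidSeq from x).comp (SlowSeq.stepL q))
  map_add' x y := by
    ext1 v; exact map_add (KoetheSpace.weightL 2 wt q) _ _
  map_smul' c x := by
    ext1 v; exact map_smul (KoetheSpace.weightL 2 wt q) _ _

theorem weighted_apply (q : ℕ) (x : SmoothOp) (v : Ell2) (j : ℕ) :
    weighted q x v j = (wt j q : ℂ) * x (SlowSeq.stepL q v) j := rfl

/-- The norm `‖x‖_q = sup {|x ξ|_q : |ξ|'_q ≤ 1}` (see `opNorm_eq_sSup`). -/
def opNorm : SeminormFamily ℂ SmoothOp ℕ :=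
  fun q => (normSeminorm ℂ (Ell2 →L[ℂ] Ell2)).comp (weighted q)

theorem opNorm_eq_sSup (q : ℕ) (x : SmoothOp) :
    opNorm q x = sSup {r : ℝ | ∃ (ξ : SlowSeq)
      (h : Memℓp (fun j => (((wt j q)⁻¹ : ℝ) : ℂ) * ξ j) 2),
      ‖(⟨_, h⟩ : Ell2)‖ ≤ 1 ∧ r = KoetheSpace.seminorm 2 wt q (x ξ)} := by
  change ‖weighted q x‖ = _
  rw [← ContinuousLinearMap.sSup_unitClosedBall_eq_norm]
  congr 1
  ext r
  constructor
  · rintro ⟨v, hv, rfl⟩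
    refine ⟨SlowSeq.stepL q v, SlowSeq.memℓp_wt_mul q v, ?_, rfl⟩
    have : (⟨_, SlowSeq.memℓp_wt_mul q v⟩ : Ell2) = v := by
      apply lp.ext; funext j
      change (((wt j q)⁻¹ : ℝ) : ℂ) * ((wt j q : ℂ) * v j) = v j
      rw [Complex.ofReal_inv, inv_mul_cancel_left₀ (wt_ne j q)]
    change ‖(⟨_, SlowSeq.memℓp_wt_mul q v⟩ : Ell2)‖ ≤ 1
    rw [this]
    simpa using hv
  · rintro ⟨ξ, h, hξ, rfl⟩
    refine ⟨⟨_, h⟩, by simpa using hξ, ?_⟩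
    have : SlowSeq.stepL q ⟨_, h⟩ = ξ := by
      ext j
      change (wt j q : ℂ) * ((((wt j q)⁻¹ : ℝ) : ℂ) * ξ j) = ξ j
      rw [Complex.ofReal_inv, mul_inv_cancel_left₀ (wt_ne j q)]
    change ‖KoetheSpace.weight 2 wt q (x (SlowSeq.stepL q ⟨_, h⟩))‖ = _
    rw [this]; rfl

/-- The topology of `L(s', s)`, given by the fundamental system of norms `(‖·‖_q)_q`. -/
instance : TopologicalSpace SmoothOp := opNorm.moduleFilterBasis.topology

theorem withSeminorms : WithSeminorms opNorm := ⟨rfl⟩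

instance : IsTopologicalAddGroup SmoothOp := withSeminorms.topologicalAddGroup
instance : ContinuousSMul ℂ SmoothOp := withSeminorms.continuousSMul

/-- The canonical embedding of `L(s', s)` into `L(ℓ₂)`: the composition
`ℓ₂ ↪ s' → s ↪ ℓ₂`. -/
def toL2 : SmoothOp →ₗ[ℂ] (Ell2 →L[ℂ] Ell2) := weighted 0

theorem toL2_apply (x : SmoothOp) (v : Ell2) (j : ℕ) :
    toL2 x v j = x (SlowSeq.stepL 0 v) j := by
  simp [toL2, weighted_apply]

theorem toL2_mul (x y : SmoothOp) : toL2 (x * y) = toL2 x * toL2 y := rfl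

/-- The unit sequences in `ℓ₂`. -/
def unit (k : ℕ) : Ell2 := lp.single 2 k (1 : ℂ)

theorem stepL_unit (q k : ℕ) :
    SlowSeq.stepL q (unit k) = (wt k q : ℂ) • SlowSeq.stepL 0 (unit k) := by
  ext j
  rw [SlowSeq.smul_apply]
  rcases eq_or_ne j k with rfl | h
  · simp [unit]
  · simp [unit, h]

theorem weighted_unit (q : ℕ) (x : SmoothOp) (j k : ℕ) :
    weighted q x (unit k) j = (wt j q : ℂ) * ((wt k q : ℂ) * toL2 x (unit k) j) := by
  rw [weighted_apply, stepL_unit, map_smul, toL2_apply, KoetheSpace.smul_apply]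

theorem ext_unit {S T : Ell2 →L[ℂ] Ell2} (h : ∀ j k, S (unit k) j = T (unit k) j) : S = T := by
  ext1 v
  have hv := lp.hasSum_single (E := fun _ : ℕ => ℂ) (p := 2) (by simp) v
  have h1 := hv.mapL S
  have h2 := hv.mapL T
  refine h1.unique ?_
  convert h2 using 2 with k
  have : lp.single 2 k (v k) = (v k) • unit k := by
    rw [unit, ← lp.single_smul]; simp
  rw [this, map_smul, map_smul]
  congr 1
  apply lp.ext; funext j; exact h j k

theorem weighted_injective (q : ℕ) : Function.Injective (weighted q) := by
  intro x y hxy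
  have h0 : ∀ j k, toL2 x (unit k) j = toL2 y (unit k) j := by
    intro j k
    have := congrArg (fun T : Ell2 →L[ℂ] Ell2 => T (unit k) j) hxy
    simp only [weighted_unit] at this
    exact mul_left_cancel₀ (wt_ne k q) (mul_left_cancel₀ (wt_ne j q) this)
  have hall : ∀ r, weighted r x = weighted r y := fun r =>
    ext_unit fun j k => by rw [weighted_unit, weighted_unit, h0]
  ext ξ j
  obtain ⟨r, hr⟩ := SlowSeq.exists_stepL ξ
  obtain ⟨v, rfl⟩ := hr r le_rfl
  have := congrArg (fun T : Ell2 →L[ℂ] Ell2 => T v j) (hall r)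
  simp only [weighted_apply] at this
  exact mul_left_cancel₀ (wt_ne j r) this

theorem toL2_injective : Function.Injective toL2 := weighted_injective 0

theorem adjoint_apply_eq (q : ℕ) (x : SmoothOp) (v : Ell2) (j : ℕ) :
    ContinuousLinearMap.adjoint (weighted q x) v j = (wt j q : ℂ) *
      ∑' k, SlowSeq.stepL q v k * (starRingEnd ℂ) (toL2 x (unit j) k) := by
  have h1 : ContinuousLinearMap.adjoint (weighted q x) v j =
      inner ℂ (unit j) (ContinuousLinearMap.adjoint (weighted q x) v) := by
    rw [unit, lp.inner_single_left]; simp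
  rw [h1, ContinuousLinearMap.adjoint_inner_right, lp.inner_eq_tsum, ← tsum_mul_left]
  congr 1
  funext k
  rw [weighted_unit, SlowSeq.stepL_apply]
  simp only [RCLike.inner_apply, map_mul, Complex.conj_ofReal]
  ring

/-- Each `x ∈ L(s', s)` has a hilbertian adjoint in `L(s', s)`. -/
theorem exists_adjoint (x : SmoothOp) :
    ∃ y : SmoothOp, toL2 y = ContinuousLinearMap.adjoint (toL2 x) := by
  classical
  let g : SlowSeq → ℕ → ℂ := fun η j => ∑' k, η k * (starRingEnd ℂ) (toL2 x (unit j) k)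
  have hg : ∀ r v j, (wt j r : ℂ) * g (SlowSeq.stepL r v) j =
      ContinuousLinearMap.adjoint (weighted r x) v j := fun r v j =>
    (adjoint_apply_eq r x v j).symm
  have hmem : ∀ η, g η ∈ koethe 2 wt := by
    intro η q
    obtain ⟨p, hp⟩ := SlowSeq.exists_stepL η
    obtain ⟨v, rfl⟩ := hp (max p q) (le_max_left _ _)
    refine (lp.memℓp (ContinuousLinearMap.adjoint (weighted (max p q) x) v)).mono' fun j => ?_
    rw [← hg, norm_mul, norm_mul]
    gcongr
    simp only [Complex.norm_real, Real.norm_eq_abs, abs_of_pos (wt_pos _ _)]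
    exact wt_mono j (le_max_right _ _)
  let G : SlowSeq →ₗ[ℂ] RapidSeq :=
    { toFun := fun η => ⟨g η, hmem η⟩
      map_add' := by
        intro ξ η
        obtain ⟨p, hp⟩ := SlowSeq.exists_stepL ξ
        obtain ⟨p', hp'⟩ := SlowSeq.exists_stepL η
        obtain ⟨v, rfl⟩ := hp (max p p') (le_max_left _ _)
        obtain ⟨w, rfl⟩ := hp' (max p p') (le_max_right _ _)
        ext j
        refine mul_left_cancel₀ (wt_ne j (max p p')) ?_
        change _ * g _ j = _ * (g _ j + g _ j)
        rw [← map_add, mul_add, hg, hg, hg, map_add]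
        rfl
      map_smul' := by
        intro c η
        obtain ⟨p, hp⟩ := SlowSeq.exists_stepL η
        obtain ⟨v, rfl⟩ := hp p le_rfl
        ext j
        refine mul_left_cancel₀ (wt_ne j p) ?_
        change _ * g _ j = _ * (c * g _ j)
        rw [← map_smul, mul_left_comm, hg, hg, map_smul]
        rfl }
  have hbound : ∀ q p, ∃ C : ℝ, ∀ v,
      KoetheSpace.seminorm 2 wt q (G (SlowSeq.step p v)) ≤ C * ‖v‖ := by
    intro q p
    have hw : ∀ v : Ell2, Memℓp (fun j => (((wt j (max p q))⁻¹ : ℝ) : ℂ) * SlowSeq.stepL p v j) 2 :=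
      fun v => memℓp_slow_mono (le_max_left p q) (SlowSeq.memℓp_wt_mul p v)
    refine ⟨‖weighted (max p q) x‖, fun v => ?_⟩
    let w : Ell2 := ⟨_, hw v⟩
    have hwv : SlowSeq.stepL (max p q) w = SlowSeq.stepL p v := by
      ext j
      change (wt j _ : ℂ) * ((((wt j _)⁻¹ : ℝ) : ℂ) * SlowSeq.stepL p v j) = SlowSeq.stepL p v j
      rw [Complex.ofReal_inv, mul_inv_cancel_left₀ (wt_ne j _)]
    have hwn : ‖w‖ ≤ ‖v‖ := by
      refine lp.norm_mono (by simp) fun j => ?_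
      change ‖(((wt j _)⁻¹ : ℝ) : ℂ) * ((wt j p : ℂ) * v j)‖ ≤ _
      rw [norm_mul, norm_mul, ← mul_assoc]
      refine mul_le_of_le_one_left (norm_nonneg _) ?_
      simp only [Complex.norm_real, Real.norm_eq_abs, abs_inv, abs_of_pos (wt_pos _ _)]
      rw [inv_mul_le_one₀ (wt_pos _ _)]
      exact wt_mono j (le_max_left _ _)
    have h1 : KoetheSpace.seminorm 2 wt q (G (SlowSeq.step p v)) ≤
        ‖ContinuousLinearMap.adjoint (weighted (max p q) x) w‖ := by
      rw [KoetheSpace.seminorm_apply]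
      refine lp.norm_mono (by simp) fun j => ?_
      rw [← hg, hwv]
      change ‖(wt j q : ℂ) * g (SlowSeq.stepL p v) j‖ ≤ _
      rw [norm_mul, norm_mul]
      gcongr
      simp only [Complex.norm_real, Real.norm_eq_abs, abs_of_pos (wt_pos _ _)]
      exact wt_mono j (le_max_right _ _)
    refine h1.trans ((ContinuousLinearMap.le_opNorm _ _).trans ?_)
    rw [LinearIsometryEquiv.norm_map]
    gcongr
  let y : SmoothOp :=
    { toLinearMap := G
      cont := by
        refine WithSeminorms.continuous_of_isBounded SlowSeq.withSeminorms
          (KoetheSpace.withSeminorms 2 wt) _ ?_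
        intro q
        let Q : SlowSeq.IndSeminorm :=
          ⟨(KoetheSpace.seminorm 2 wt q).comp G, fun p => hbound q p⟩
        have hQ : (KoetheSpace.seminorm 2 wt q).comp G = SlowSeq.seminorm Q := rfl
        exact ⟨{Q}, 1, by rw [one_smul, Finset.sup_singleton, hQ]⟩ }
  refine ⟨y, ?_⟩
  ext1 v
  apply lp.ext; funext j
  exact hg 0 v j

/-- The hilbertian involution `x ↦ x*` of `L(s', s)`. -/
instance : Star SmoothOp := ⟨fun x => (exists_adjoint x).choose⟩

theorem toL2_star (x : SmoothOp) : toL2 (star x) = ContinuousLinearMap.adjoint (toL2 x) :=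
  (exists_adjoint x).choose_spec

instance : StarRing SmoothOp where
  star_involutive x := toL2_injective (by simp [toL2_star])
  star_mul x y := toL2_injective (by
    rw [toL2_star, toL2_mul, toL2_mul, toL2_star, toL2_star]
    exact ContinuousLinearMap.adjoint_comp _ _)
  star_add x y := toL2_injective (by simp [toL2_star])

instance : StarModule ℂ SmoothOp :=
  ⟨fun c x => toL2_injective (by
    rw [toL2_star, map_smul toL2 c x, map_smul toL2 (star c), toL2_star]
    exact LinearIsometryEquiv.map_smulₛₗ _ _ _)⟩

/-- `x` is a projection: its canonical inclusion in `L(ℓ₂)` is an orthogonal projection. -/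
def IsProj (x : SmoothOp) : Prop := IsStarProjection (toL2 x)

/-- `x` is finite dimensional, i.e. has finite-dimensional range. -/
def IsFinDim (x : SmoothOp) : Prop := FiniteDimensional ℂ (LinearMap.range (toL2 x).toLinearMap)

end SmoothOp

/-! ### Notions in the statement -/

/-- The nonzero projections that belong to `A`. -/
def projections (A : Set SmoothOp) : Set SmoothOp := {P | P ∈ A ∧ P.IsProj ∧ P ≠ 0}

/-- The minimal elements of `projections A` for the order `Q ⪯ P ↔ QP = PQ = Q`. -/
def minimalProjections (A : Set SmoothOp) : Set SmoothOp :=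
  {P | P ∈ projections A ∧ ∀ Q ∈ projections A, Q * P = Q ∧ P * Q = Q → Q = P}

/-- `alg(Z)`: the closed `*`-subalgebra generated by `Z`, i.e. the smallest closed
`*`-subalgebra containing `Z`. -/
def alg (Z : Set SmoothOp) : NonUnitalStarSubalgebra ℂ SmoothOp :=
  sInf {B | IsClosed (B : Set SmoothOp) ∧ Z ⊆ B}

/-- `(e_n)` is a Schauder basis of `E`: each `x` has a unique expansion `x = ∑ c_n e_n`
(convergence of the partial sums), and the coefficients are continuous linear functionals. -/
def IsSchauderBasis {E : Type*} [AddCommGroup E] [Module ℂ E] [TopologicalSpace E]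
    (e : ℕ → E) : Prop :=
  ∃ f : ℕ → E →L[ℂ] ℂ, ∀ (x : E) (c : ℕ → ℂ),
    Tendsto (fun N => ∑ n ∈ Finset.range N, c n • e n) atTop (𝓝 x) ↔ ∀ n, c n = f n x

/-- `x = ∑ μ_n P_n` is the spectral representation of `x`: `(μ_n)` is a sequence in `s` of nonzero,
pairwise different numbers with decreasing moduli, the `P_n` are nonzero, pairwise orthogonal,
finite-dimensional projections, and the series converges absolutely to `x` in `L(s', s)`. -/
structure IsSpectralRep (x : SmoothOp) (μ : ℕ → ℂ) (P : ℕ → SmoothOp) : Prop where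
  antitone : Antitone fun n => ‖μ n‖
  mem_rapid : μ ∈ koethe 2 wt
  ne_zero : ∀ n, μ n ≠ 0
  injective : Function.Injective μ
  proj : ∀ n, (P n).IsProj ∧ P n ≠ 0 ∧ (P n).IsFinDim
  orthogonal : ∀ m n, m ≠ n → P m * P n = 0
  summable : ∀ q, Summable fun n => SmoothOp.opNorm q (μ n • P n)
  tendsto : Tendsto (fun N => ∑ n ∈ Finset.range N, μ n • P n) atTop (𝓝 x)

end SmoothOperators

end

open SmoothOperators

/-! Inside L(ℓ₂) every x in L(s',s) is compact, because it factors through the compact diagonal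
operator with entries 1/(j+1). For y ≠ 0 in A, let z be y*y scaled to operator norm one. Its powers
converge in operator norm to the projection onto the eigenspace for 1
(`IsCompactOperator.exists_tendsto_pow`). Writing z^(n+3) = z·z^(n+1)·z upgrades this to convergence
in every ‖·‖_q, since the outer factors absorb the weights; as A is closed, the limit projection
lies in A (`exists_spectral_projection`).

Projections in L(s',s) have finite rank, so each one in A dominates a minimal one. By commutativity
the minimal ones are mutually orthogonal, A acts on each by a scalar, xP_n = c_n(x)P_n
(`exists_mul_eq_smul`), and x = 0 as soon as all c_n(x) vanish (`eq_zero_of_forall_mul_eq_zero`). If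
there were only finitely many, the c_n would embed A in a finite-dimensional space.

The analysis rests on two facts about projections. From P = PP* and the C*-identity one gets ‖P‖_q²
≤ ‖P‖_{2q} and |c_n(x)| ‖P_n‖_q ≤ ‖x‖_{2q}. From Bessel's inequality and ∑ (j+1)^(-2) < ∞ one gets ∑
1/‖P_n‖_1 < ∞ (`summable_inv_opNorm_one`), which also makes the family countable. Together they give
the Grothendieck–Pietsch condition ‖P_n‖_q ≤ ‖P_n‖_1⁻¹ ‖P_n‖_{2(q+1)}. Bounds on the coordinates
thus become absolute convergence of ∑ c_n(x)P_n, whence the basis, the isomorphism with λ¹ and the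
equality λ¹ = λ^∞.

A generator is x = ∑ μ_n P_n with μ_n positive, strictly decreasing and decaying fast enough: remove
the first n terms, divide by μ_n, and the powers converge to P_n (`basis_mem_of_strictAnti`). -/

noncomputable section

/-! ### Powers of positive compact operators -/

section CompactPositive

variable {H : Type*} [NormedAddCommGroup H] [InnerProductSpace ℂ H] [CompleteSpace H]

/-- The norm of a nonzero positive compact operator is an eigenvalue. -/
theorem IsCompactOperator.exists_apply_eq_norm_smul {T : H →L[ℂ] H} (hT : IsCompactOperator T)
    (hpos : 0 ≤ T) (hne : T ≠ 0) : ∃ v, v ≠ 0 ∧ T v = (‖T‖ : ℂ) • v := by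
  have hnt : Nontrivial (H →L[ℂ] H) := ⟨T, 0, hne⟩
  have h1 : ‖T‖ ∈ spectrum ℝ T := CStarAlgebra.norm_mem_spectrum_of_nonneg hpos
  have h2 : (‖T‖ : ℂ) ∈ spectrum ℂ T := (spectrum.algebraMap_mem_iff ℂ).mpr h1
  have h3 : (‖T‖ : ℂ) ≠ 0 := by simpa using hne
  obtain ⟨v, hv⟩ := ((hT.hasEigenvalue_iff_mem_spectrum h3).mpr h2).exists_hasEigenvector
  exact ⟨v, hv.2, hv.apply_eq_smul⟩

/-- The powers of a positive compact operator of norm one converge to a nonzero projection. -/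
theorem IsCompactOperator.exists_tendsto_pow {S : H →L[ℂ] H} (hS : IsCompactOperator S)
    (hpos : 0 ≤ S) (hnorm : ‖S‖ = 1) :
    ∃ E : H →L[ℂ] H, IsStarProjection E ∧ E ≠ 0 ∧ S * E = E ∧
      Tendsto (fun n => S ^ n) atTop (𝓝 E) := by
  have hS0 : S ≠ 0 := by rintro rfl; simp at hnorm
  obtain ⟨v, hv0, hv⟩ := hS.exists_apply_eq_norm_smul hpos hS0
  rw [hnorm, Complex.ofReal_one, one_smul] at hv
  let K := Module.End.eigenspace S.toLinearMap 1
  have hfin : FiniteDimensional ℂ K :=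
    ContinuousLinearMap.finite_dimensional_eigenspace hS 1 one_ne_zero
  have hK : ∀ w, w ∈ K ↔ S w = w := fun w => by
    rw [Module.End.mem_eigenspace_iff, one_smul]; rfl
  let E : H →L[ℂ] H := K.starProjection
  have hE : IsStarProjection E := isStarProjection_starProjection
  have hEK : ∀ w, E w ∈ K := fun w => Submodule.starProjection_apply_mem K w
  have hEid : ∀ w ∈ K, E w = w := fun w hw => Submodule.starProjection_eq_self_iff.mpr hw
  have hSE : S * E = E := by
    ext1 w; exact (hK _).mp (hEK w)
  have hSs : star S = S := (IsSelfAdjoint.of_nonneg hpos).star_eq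
  have hEs : star E = E := hE.isSelfAdjoint.star_eq
  have hEE : E * E = E := hE.isIdempotentElem
  have hES : E * S = E := by
    have := congrArg star hSE
    rwa [star_mul, hSs, hEs] at this
  have hE0 : E ≠ 0 := by
    intro h
    have := hEid v ((hK v).mpr hv)
    rw [h] at this
    exact hv0 (by simpa using this.symm)
  -- Being a compression of `S`, the difference `S - E` is again positive and compact, so its norm
  -- is an eigenvalue.
  have hdiff : star (1 - E) * S * (1 - E) = S - E := by
    rw [star_sub, hEs, star_one]
    simp only [sub_mul, mul_sub, one_mul, mul_one, hES, hSE, hEE]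
    abel
  have hlt : ‖S - E‖ < 1 := by
    rcases eq_or_ne (S - E) 0 with h0 | h0
    · simp [h0]
    have hc : IsCompactOperator (S - E) := by
      have h1 := (hS.comp_clm (1 - E)).clm_comp (star (1 - E))
      rw [← hdiff]
      exact h1
    obtain ⟨w, hw0, hw⟩ := hc.exists_apply_eq_norm_smul
      (hdiff ▸ star_left_conjugate_nonneg hpos (1 - E)) h0
    have hr : (‖S - E‖ : ℂ) ≠ 0 := by simpa using h0
    have hEw : E w = 0 := by
      have h1 : E ((S - E) w) = 0 := by
        change (E * (S - E)) w = 0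
        rw [mul_sub, hES, hEE, sub_self]; rfl
      rw [hw, map_smul] at h1
      exact (smul_eq_zero.mp h1).resolve_left hr
    have hSw : S w = (‖S - E‖ : ℂ) • w := by
      rw [← hw, sub_apply, hEw, sub_zero]
    have hle : ‖S - E‖ ≤ 1 := by
      have h1 := S.le_opNorm w
      rw [hSw, norm_smul, hnorm, Complex.norm_real, norm_norm] at h1
      exact le_of_mul_le_mul_right h1 (norm_pos_iff.mpr hw0)
    -- At norm one, `w` would be fixed by `S`, hence lie in `K`, yet `E` kills it.
    refine lt_of_le_of_ne hle fun h1 => hw0 ?_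
    rw [h1, Complex.ofReal_one, one_smul] at hSw
    rw [← hEid w ((hK w).mpr hSw), hEw]
  -- The mixed products of `E` and `S - E` vanish, so powers split; the exponent starts at one
  -- because the identity fails for the zeroth power.
  have hpow : ∀ n : ℕ, S ^ (n + 1) = E + (S - E) ^ (n + 1) := by
    intro n
    induction n with
    | zero => simp
    | succ n ih =>
      have h1 : E * (S - E) = 0 := by rw [mul_sub, hES, hEE, sub_self]
      have h2 : (S - E) ^ (n + 1) * E = 0 := by
        rw [pow_succ, mul_assoc, sub_mul, hSE, hEE, sub_self, mul_zero]
      calc S ^ (n + 1 + 1) = (E + (S - E) ^ (n + 1)) * (E + (S - E)) := by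
            rw [pow_succ, ih]; simp
        _ = E + (S - E) ^ (n + 1 + 1) := by
            rw [add_mul, mul_add, mul_add, hEE, h1, h2, ← pow_succ]; simp
  refine ⟨E, hE, hE0, hSE, ?_⟩
  rw [← tendsto_add_atTop_iff_nat 1]
  simp only [hpow]
  have h := (tendsto_add_atTop_iff_nat 1).mpr (tendsto_pow_atTop_nhds_zero_of_norm_lt_one hlt)
  simpa using h.const_add E

end CompactPositive

/-! ### Diagonal weights on ℓ₂ -/

namespace SmoothOperators

open ContinuousLinearMap (adjoint)

theorem wt_mul_self (j q : ℕ) : wt j q * wt j q = wt j (2 * q) := by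
  rw [wt, wt, ← pow_add, two_mul]

theorem wt_add (j p q : ℕ) : wt j (p + q) = wt j p * wt j q := pow_add _ _ _

theorem one_le_wt (j q : ℕ) : 1 ≤ wt j q := by
  simpa using wt_mono j (Nat.zero_le q)

theorem Ell2.inner_unit_left (k : ℕ) (v : Ell2) : inner ℂ (SmoothOp.unit k) v = v k := by
  rw [SmoothOp.unit, lp.inner_single_left]; simp

theorem Ell2.norm_unit (k : ℕ) : ‖SmoothOp.unit k‖ = 1 := by
  rw [SmoothOp.unit, lp.norm_single (by simp)]; simp

/-- Multiplication by the sequence `((j+1)^{-q})_j`. -/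
def invWeight (q : ℕ) : Ell2 →L[ℂ] Ell2 :=
  LinearMap.mkContinuous
    { toFun := fun v => ⟨fun j => (((wt j q)⁻¹ : ℝ) : ℂ) * v j,
        memℓp_slow_mono (Nat.zero_le q) (by simpa using lp.memℓp v)⟩
      map_add' := fun v w => by
        apply lp.ext; funext j
        exact mul_add _ _ _
      map_smul' := fun c v => by
        apply lp.ext; funext j
        exact mul_left_comm _ _ _ } 1 fun v => by
    rw [one_mul]
    refine lp.norm_mono (by simp) fun j => ?_
    change ‖(((wt j q)⁻¹ : ℝ) : ℂ) * v j‖ ≤ _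
    rw [norm_mul, Complex.norm_real, Real.norm_eq_abs, abs_inv, abs_of_pos (wt_pos _ _)]
    exact mul_le_of_le_one_left (norm_nonneg _) (inv_le_one_of_one_le₀ (one_le_wt j q))

@[simp] theorem invWeight_apply (q : ℕ) (v : Ell2) (j : ℕ) :
    invWeight q v j = (((wt j q)⁻¹ : ℝ) : ℂ) * v j := rfl

theorem norm_invWeight_le (q : ℕ) : ‖invWeight q‖ ≤ 1 :=
  LinearMap.mkContinuous_norm_le _ zero_le_one _

theorem stepL_invWeight (p q : ℕ) (v : Ell2) :
    SlowSeq.stepL (p + q) (invWeight q v) = SlowSeq.stepL p v := by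
  ext j
  rw [SlowSeq.stepL_apply, SlowSeq.stepL_apply, invWeight_apply, wt_add, Complex.ofReal_mul,
    Complex.ofReal_inv, mul_assoc, mul_inv_cancel_left₀ (wt_ne j q)]

theorem invWeight_weightL (p q : ℕ) (ξ : RapidSeq) :
    invWeight q (KoetheSpace.weightL 2 wt (p + q) ξ) = KoetheSpace.weightL 2 wt p ξ := by
  apply lp.ext; funext j
  change (((wt j q)⁻¹ : ℝ) : ℂ) * ((wt j (p + q) : ℂ) * ξ j) = (wt j p : ℂ) * ξ j
  rw [add_comm p q, wt_add, Complex.ofReal_mul, mul_assoc, Complex.ofReal_inv,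
    inv_mul_cancel_left₀ (wt_ne j q)]

/-- Truncation to the first `N` coordinates has finite rank, and the discarded weights are at most
1/(N+1). -/
theorem isCompactOperator_invWeight : IsCompactOperator (invWeight 1) := by
  let F : ℕ → Ell2 →L[ℂ] Ell2 := fun N => ∑ k ∈ Finset.range N,
    ((innerSL ℂ (SmoothOp.unit k)).smulRight ((((wt k 1)⁻¹ : ℝ) : ℂ) • SmoothOp.unit k))
  have hF : ∀ N v j, F N v j = if j < N then (((wt j 1)⁻¹ : ℝ) : ℂ) * v j else 0 := by
    intro N v j
    have h1 : F N v = ∑ k ∈ Finset.range N,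
        v k • ((((wt k 1)⁻¹ : ℝ) : ℂ) • SmoothOp.unit k) := by
      simp only [F, sum_apply, ContinuousLinearMap.smulRight_apply,
        innerSL_apply_apply, Ell2.inner_unit_left]
    rw [h1, lp.coeFn_sum, Finset.sum_apply]
    have h2 : ∀ k, (v k • ((((wt k 1)⁻¹ : ℝ) : ℂ) • SmoothOp.unit k) : Ell2) j =
        if k = j then (((wt j 1)⁻¹ : ℝ) : ℂ) * v j else 0 := by
      intro k
      rw [lp.coeFn_smul, Pi.smul_apply, lp.coeFn_smul, Pi.smul_apply, SmoothOp.unit]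
      split_ifs with h
      · subst h; simp [mul_comm]
      · simp [lp.single_apply, Ne.symm h]
    simp only [h2, Finset.sum_ite_eq', Finset.mem_range]
  have hc : ∀ N, IsCompactOperator (F N) := by
    intro N
    have : F N ∈ compactOperator (RingHom.id ℂ) Ell2 Ell2 := by
      refine Submodule.sum_mem _ fun k _ => ?_
      exact (isCompactOperator_of_locallyCompactSpace_dom
        (innerSL ℂ (SmoothOp.unit k))).clm_comp
          (ContinuousLinearMap.toSpanSingleton ℂ ((((wt k 1)⁻¹ : ℝ) : ℂ) • SmoothOp.unit k))
    exact this
  refine isCompactOperator_of_tendsto (F := F) (l := atTop) ?_ (Eventually.of_forall hc)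
  rw [tendsto_iff_norm_sub_tendsto_zero]
  refine squeeze_zero (fun _ => norm_nonneg _) (fun N => ?_) tendsto_one_div_add_atTop_nhds_zero_nat
  refine ContinuousLinearMap.opNorm_le_bound _ (by positivity) fun v => ?_
  have h3 : 1 / ((N : ℝ) + 1) * ‖v‖ = ‖((1 / ((N : ℝ) + 1) : ℝ) : ℂ) • v‖ := by
    rw [norm_smul, Complex.norm_real, Real.norm_of_nonneg (by positivity)]
  rw [h3]
  refine lp.norm_mono (by simp) fun j => ?_
  rw [sub_apply, lp.coeFn_sub, Pi.sub_apply, hF, invWeight_apply, lp.coeFn_smul, Pi.smul_apply,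
    norm_smul]
  split_ifs with h
  · simp only [sub_self, norm_zero]; positivity
  · rw [zero_sub, norm_neg, norm_mul]
    gcongr
    rw [Complex.norm_real, Complex.norm_real, Real.norm_of_nonneg (inv_nonneg.mpr (wt_pos j 1).le),
      Real.norm_of_nonneg (by positivity), wt, pow_one, one_div]
    gcongr
    exact not_lt.mp h

/-! ### One-sided weights and the norms ‖·‖_q -/

namespace SmoothOp

/-- The operator `W_q ∘ x` on `ℓ₂`. -/
def left (q : ℕ) : SmoothOp →ₗ[ℂ] (Ell2 →L[ℂ] Ell2) where
  toFun x := (KoetheSpace.weightL 2 wt q).comp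
    ((show SlowSeq →L[ℂ] RapidSeq from x).comp (SlowSeq.stepL 0))
  map_add' x y := by
    ext1 v; exact map_add (KoetheSpace.weightL 2 wt q) _ _
  map_smul' c x := by
    ext1 v; exact map_smul (KoetheSpace.weightL 2 wt q) _ _

/-- The operator `x ∘ D_q` on `ℓ₂`. -/
def right (q : ℕ) : SmoothOp →ₗ[ℂ] (Ell2 →L[ℂ] Ell2) where
  toFun x := (KoetheSpace.weightL 2 wt 0).comp
    ((show SlowSeq →L[ℂ] RapidSeq from x).comp (SlowSeq.stepL q))
  map_add' x y := by
    ext1 v; exact map_add (KoetheSpace.weightL 2 wt 0) _ _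
  map_smul' c x := by
    ext1 v; exact map_smul (KoetheSpace.weightL 2 wt 0) _ _

theorem left_apply (q : ℕ) (x : SmoothOp) (v : Ell2) (j : ℕ) :
    left q x v j = (wt j q : ℂ) * toL2 x v j := by
  rw [toL2_apply]; rfl

theorem right_apply (q : ℕ) (x : SmoothOp) (v : Ell2) (j : ℕ) :
    right q x v j = x (SlowSeq.stepL q v) j := by
  change (wt j 0 : ℂ) * x (SlowSeq.stepL q v) j = _
  simp

/-- The inclusion of s in s' passes through ℓ₂, so a product splits there: the left factor carries
the weight of the range, the right factor that of the domain. -/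
theorem weighted_mul (q : ℕ) (x y : SmoothOp) :
    weighted q (x * y) = left q x * right q y := rfl

theorem weighted_mul_mul (q : ℕ) (x y z : SmoothOp) :
    weighted q (x * y * z) = left q x * toL2 y * right q z := rfl

theorem left_mul (q : ℕ) (x y : SmoothOp) : left q (x * y) = left q x * toL2 y := rfl

theorem opNorm_apply (q : ℕ) (x : SmoothOp) : opNorm q x = ‖weighted q x‖ := rfl

/-- This relation gives the monotonicity of the norms, and it is the gluing condition in
`exists_weighted_eq`. -/
theorem weighted_add (p q : ℕ) (x : SmoothOp) :
    weighted p x = invWeight q * weighted (p + q) x * invWeight q := by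
  ext1 v
  change KoetheSpace.weightL 2 wt p (x (SlowSeq.stepL p v)) =
    invWeight q (KoetheSpace.weightL 2 wt (p + q) (x (SlowSeq.stepL (p + q) (invWeight q v))))
  rw [stepL_invWeight, invWeight_weightL]

theorem opNorm_mono {p q : ℕ} (h : p ≤ q) (x : SmoothOp) : opNorm p x ≤ opNorm q x := by
  obtain ⟨r, rfl⟩ := Nat.exists_eq_add_of_le h
  rw [opNorm_apply, opNorm_apply, weighted_add p r]
  calc _ ≤ ‖invWeight r‖ * ‖weighted (p + r) x‖ * ‖invWeight r‖ :=
        (norm_mul_le _ _).trans (by gcongr; exact norm_mul_le _ _)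
    _ ≤ 1 * ‖weighted (p + r) x‖ * 1 := by
        gcongr <;> exact norm_invWeight_le r
    _ = _ := by ring

theorem norm_left_le (q : ℕ) (x : SmoothOp) : ‖left q x‖ ≤ opNorm q x := by
  have h : left q x = weighted q x * invWeight q := by
    ext1 v
    change KoetheSpace.weightL 2 wt q (x (SlowSeq.stepL 0 v)) =
      KoetheSpace.weightL 2 wt q (x (SlowSeq.stepL q (invWeight q v)))
    rw [← stepL_invWeight 0 q, zero_add]
  rw [h, opNorm_apply]
  calc _ ≤ ‖weighted q x‖ * ‖invWeight q‖ := norm_mul_le _ _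
    _ ≤ ‖weighted q x‖ * 1 := by gcongr; exact norm_invWeight_le q
    _ = _ := mul_one _

/-- The range lies in s, so one weight can be gained and then undone by the compact `invWeight 1`.
-/
theorem isCompactOperator_toL2 (x : SmoothOp) : IsCompactOperator (toL2 x) := by
  have h : toL2 x = invWeight 1 * left 1 x := by
    ext1 v
    exact (invWeight_weightL 0 1 _).symm
  rw [h]
  exact isCompactOperator_invWeight.comp_clm (left 1 x)

theorem right_unit (q : ℕ) (x : SmoothOp) (j k : ℕ) :
    right q x (unit k) j = (wt k q : ℂ) * toL2 x (unit k) j := by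
  rw [right_apply, stepL_unit, map_smul, toL2_apply, KoetheSpace.smul_apply]

theorem adjoint_unit (T : Ell2 →L[ℂ] Ell2) (j k : ℕ) :
    adjoint T (unit k) j = (starRingEnd ℂ) (T (unit j) k) := by
  rw [← Ell2.inner_unit_left, ContinuousLinearMap.adjoint_inner_right, ← inner_conj_symm,
    Ell2.inner_unit_left]

/-- The weights are real and diagonal, so formally (W_q x)* = x* D_q. Comparing matrix entries
avoids adjoints of unbounded operators. -/
theorem right_star (q : ℕ) (x : SmoothOp) : right q (star x) = star (left q x) := by
  refine ext_unit fun j k => ?_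
  rw [right_unit, toL2_star, adjoint_unit, ContinuousLinearMap.star_eq_adjoint, adjoint_unit,
    left_apply, map_mul, Complex.conj_ofReal]

/-- In (W_q x)*(W_q x) the two inner weights of order q meet and merge into one of order 2q. This is
the source of the index doubling in the estimates for projections. -/
theorem star_left_mul_left (q : ℕ) (x : SmoothOp) :
    star (left q x) * left q x = toL2 (star x) * left (2 * q) x := by
  rw [← right_star]
  ext1 v
  change KoetheSpace.weightL 2 wt 0 (star x (SlowSeq.stepL q (left q x v))) =
    KoetheSpace.weightL 2 wt 0 (star x (SlowSeq.stepL 0 (left (2 * q) x v)))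
  congr 2
  ext j
  rw [SlowSeq.stepL_apply, SlowSeq.stepL_apply, left_apply, left_apply, ← mul_assoc,
    ← Complex.ofReal_mul, wt_mul_self, wt_zero, Complex.ofReal_one, one_mul]

/-! ### Norm estimates for projections -/

namespace IsProj

variable {P : SmoothOp}

theorem star_eq (hP : P.IsProj) : star P = P := by
  apply toL2_injective
  rw [toL2_star]
  exact hP.isSelfAdjoint.star_eq

theorem mul_self (hP : P.IsProj) : P * P = P := by
  apply toL2_injective
  rw [toL2_mul]
  exact hP.isIdempotentElem

theorem of_star_of_mul (h1 : star P = P) (h2 : P * P = P) : P.IsProj where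
  isIdempotentElem := by
    change toL2 P * toL2 P = toL2 P
    rw [← toL2_mul, h2]
  isSelfAdjoint := by
    change star (toL2 P) = toL2 P
    rw [ContinuousLinearMap.star_eq_adjoint, ← toL2_star, h1]

/-- Since P = PP*, the doubly weighted operator is (W_q P)(W_q P)*, and the C*-identity applies. -/
theorem opNorm_eq (hP : P.IsProj) (q : ℕ) : opNorm q P = ‖left q P‖ ^ 2 := by
  have h : weighted q P = left q P * star (left q P) := by
    rw [← right_star, hP.star_eq, ← weighted_mul, hP.mul_self]
  rw [opNorm_apply, h, sq]
  exact CStarRing.norm_self_mul_star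

theorem norm_toL2_le (hP : P.IsProj) : ‖toL2 P‖ ≤ 1 := IsStarProjection.norm_le _ hP

/-- The product in the other order, (W_q P)*(W_q P), has the same norm and equals P W_{2q} P. -/
theorem opNorm_le_norm_left (hP : P.IsProj) (q : ℕ) : opNorm q P ≤ ‖left (2 * q) P‖ := by
  rw [hP.opNorm_eq, sq, ← CStarRing.norm_star_mul_self, star_left_mul_left, hP.star_eq]
  calc _ ≤ ‖toL2 P‖ * ‖left (2 * q) P‖ := norm_mul_le _ _
    _ ≤ 1 * ‖left (2 * q) P‖ := by gcongr; exact hP.norm_toL2_le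
    _ = _ := one_mul _

theorem opNorm_sq_le (hP : P.IsProj) (q : ℕ) : opNorm q P ^ 2 ≤ opNorm (2 * q) P := by
  rw [hP.opNorm_eq (2 * q)]
  gcongr
  exact hP.opNorm_le_norm_left q

/-- If `x P = c P`, then `|c| ‖P‖_q ≤ ‖x‖_{2q}`. -/
theorem norm_mul_opNorm_le (hP : P.IsProj) {x : SmoothOp} {c : ℂ} (h : x * P = c • P) (q : ℕ) :
    ‖c‖ * opNorm q P ≤ opNorm (2 * q) x :=
  calc ‖c‖ * opNorm q P ≤ ‖c‖ * ‖left (2 * q) P‖ := by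
        gcongr; exact hP.opNorm_le_norm_left q
    _ = ‖left (2 * q) x * toL2 P‖ := by rw [← norm_smul, ← map_smul, ← h, left_mul]
    _ ≤ ‖left (2 * q) x‖ * ‖toL2 P‖ := norm_mul_le _ _
    _ ≤ ‖left (2 * q) x‖ * 1 := by gcongr; exact hP.norm_toL2_le
    _ ≤ opNorm (2 * q) x := by rw [mul_one]; exact norm_left_le _ _

/-- The range consists of eigenvectors of a compact operator for the eigenvalue 1. -/
theorem isFinDim (hP : P.IsProj) : P.IsFinDim := by
  have h := ContinuousLinearMap.finite_dimensional_eigenspace (isCompactOperator_toL2 P) 1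
    one_ne_zero
  refine Submodule.finiteDimensional_of_le (S₂ := Module.End.eigenspace (toL2 P).toLinearMap 1) ?_
  rintro _ ⟨v, rfl⟩
  rw [Module.End.mem_eigenspace_iff, one_smul]
  change (toL2 P * toL2 P) v = toL2 P v
  rw [← toL2_mul, hP.mul_self]

theorem exists_unit_vector (hP : P.IsProj) (h0 : P ≠ 0) : ∃ v, toL2 P v = v ∧ ‖v‖ = 1 := by
  have h1 : toL2 P ≠ 0 := fun h => h0 (toL2_injective (by rw [h, map_zero]))
  obtain ⟨w, hw⟩ : ∃ w, toL2 P w ≠ 0 := by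
    by_contra! h
    exact h1 (ContinuousLinearMap.ext h)
  have h2 : toL2 P (toL2 P w) = toL2 P w := by
    change (toL2 P * toL2 P) w = toL2 P w
    rw [← toL2_mul, hP.mul_self]
  refine ⟨(‖toL2 P w‖⁻¹ : ℂ) • toL2 P w, by rw [map_smul, h2], ?_⟩
  rw [norm_smul, norm_inv, Complex.norm_real, norm_norm, inv_mul_cancel₀ (norm_ne_zero_iff.mpr hw)]

theorem one_le_opNorm (hP : P.IsProj) (h0 : P ≠ 0) (q : ℕ) : 1 ≤ opNorm q P := by
  obtain ⟨v, hv, hv1⟩ := hP.exists_unit_vector h0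
  have h := (toL2 P).le_opNorm v
  rw [hv, hv1, mul_one] at h
  exact h.trans (opNorm_mono (Nat.zero_le q) P)

/-- Moving one weight across the inner product gives 1 = ⟨v, v⟩ = ⟨W₁⁻¹v, W₁Pv⟩ ≤ ‖W₁⁻¹v‖ ‖W₁P‖, and
‖P‖₁ is the square of the last factor. The resulting bound is summable over orthonormal systems
because W₁⁻¹ is Hilbert–Schmidt. -/
theorem inv_opNorm_one_le (hP : P.IsProj) {v : Ell2} (hv : toL2 P v = v) (hv1 : ‖v‖ = 1) :
    (opNorm 1 P)⁻¹ ≤ ‖invWeight 1 v‖ ^ 2 := by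
  have h1 : inner ℂ (invWeight 1 v) (left 1 P v) = inner ℂ v v := by
    rw [lp.inner_eq_tsum, lp.inner_eq_tsum]
    congr 1; funext j
    rw [left_apply, hv, invWeight_apply]
    simp only [RCLike.inner_apply, map_mul, Complex.conj_ofReal]
    have := wt_ne j 1
    rw [Complex.ofReal_inv]
    field_simp
  have h2 : 1 ≤ ‖invWeight 1 v‖ * ‖left 1 P‖ := by
    have h3 := norm_inner_le_norm (𝕜 := ℂ) (invWeight 1 v) (left 1 P v)
    rw [h1, inner_self_eq_norm_sq_to_K, hv1] at h3
    have h4 := (left 1 P).le_opNorm v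
    rw [hv1, mul_one] at h4
    calc (1 : ℝ) ≤ ‖invWeight 1 v‖ * ‖left 1 P v‖ := by simpa using h3
      _ ≤ _ := by gcongr
  rw [hP.opNorm_eq]
  have h5 : 0 < ‖left 1 P‖ := by
    by_contra h
    have : ‖left 1 P‖ = 0 := le_antisymm (not_lt.mp h) (norm_nonneg _)
    rw [this, mul_zero] at h2
    linarith
  rw [inv_le_iff_one_le_mul₀ (by positivity), ← mul_pow]
  exact one_le_pow₀ h2

end IsProj

/-- The Grothendieck–Pietsch condition for a family of orthogonal projections in `L(s', s)`. -/
theorem summable_inv_opNorm_one {ι : Type*} {P : ι → SmoothOp} (hP : ∀ i, (P i).IsProj)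
    (h0 : ∀ i, P i ≠ 0) (horth : ∀ i j, i ≠ j → P i * P j = 0) :
    Summable fun i => (opNorm 1 (P i))⁻¹ := by
  choose v hv hv1 using fun i => (hP i).exists_unit_vector (h0 i)
  have hon : Orthonormal ℂ v := by
    refine ⟨hv1, fun i j hij => ?_⟩
    change inner ℂ (v i) (v j) = 0
    rw [← hv i, ← hv j, ← ContinuousLinearMap.adjoint_inner_right, ← toL2_star, (hP i).star_eq]
    have h1 : toL2 (P i) (toL2 (P j) (v j)) = toL2 (P i * P j) (v j) := rfl
    rw [h1, horth i j hij, map_zero]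
    simp
  -- The sum is the squared Hilbert–Schmidt norm of `invWeight 1`; it bounds all finite partial
  -- sums.
  have hs : Summable fun j : ℕ => ((wt j 1)⁻¹) ^ 2 := by
    have := (summable_nat_add_iff 1).mpr (Real.summable_nat_pow_inv.mpr one_lt_two)
    refine this.congr fun j => ?_
    rw [wt, pow_one, inv_pow]
    push_cast
    rfl
  have hnorm : ∀ w : Ell2, HasSum (fun j => ((wt j 1)⁻¹) ^ 2 * ‖w j‖ ^ 2) (‖invWeight 1 w‖ ^ 2) := by
    intro w
    have h1 := lp.hasSum_norm (p := 2) (by simp) (invWeight 1 w)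
    simp only [ENNReal.toReal_ofNat, Real.rpow_ofNat] at h1
    convert h1 using 2 with j
    rw [invWeight_apply, norm_mul, Complex.norm_real,
      Real.norm_of_nonneg (inv_nonneg.mpr (wt_pos j 1).le), mul_pow]
  refine summable_of_sum_le (c := ∑' j : ℕ, ((wt j 1)⁻¹) ^ 2)
    (fun i => inv_nonneg.mpr (apply_nonneg _ _)) fun F => ?_
  calc ∑ i ∈ F, (opNorm 1 (P i))⁻¹ ≤ ∑ i ∈ F, ‖invWeight 1 (v i)‖ ^ 2 :=
        Finset.sum_le_sum fun i _ => (hP i).inv_opNorm_one_le (hv i) (hv1 i)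
    _ ≤ ∑' j : ℕ, ((wt j 1)⁻¹) ^ 2 := by
        refine hasSum_le (fun j => ?_) (hasSum_sum fun i (_ : i ∈ F) => hnorm (v i)) hs.hasSum
        rw [← Finset.mul_sum]
        refine mul_le_of_le_one_right (by positivity) ?_
        -- Bessel's inequality for the j-th unit sequence: the squared j-th coordinates of the `v i`
        -- add up to at most one.
        have h2 := hon.sum_inner_products_le (x := unit j) (s := F)
        rw [Ell2.norm_unit, one_pow] at h2
        refine le_trans (le_of_eq (Finset.sum_congr rfl fun i _ => ?_)) h2
        rw [norm_inner_symm, Ell2.inner_unit_left]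

end SmoothOp

/-! ### Gluing operators on the steps, and completeness -/

theorem SlowSeq.stepL_injective (q : ℕ) : Function.Injective (SlowSeq.stepL q) := by
  intro v w h
  apply lp.ext; funext j
  have := congrArg (fun η : SlowSeq => η j) h
  simp only [SlowSeq.stepL_apply] at this
  exact mul_left_cancel₀ (wt_ne j q) this

namespace SmoothOp

/-- A compatible family of operators on the steps defines an element of `L(s', s)`. -/
theorem exists_weighted_eq (S : ℕ → Ell2 →L[ℂ] Ell2)
    (hS : ∀ p r, S p = invWeight r * S (p + r) * invWeight r) :
    ∃ x : SmoothOp, ∀ q, weighted q x = S q := by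
  have hstep : ∀ r d v j, (wt j r : ℂ)⁻¹ * S r v j =
      (wt j (r + d) : ℂ)⁻¹ * S (r + d) (invWeight d v) j := by
    intro r d v j
    have h1 : S r v j = invWeight d (S (r + d) (invWeight d v)) j := by
      rw [hS r d]; rfl
    rw [h1, invWeight_apply, wt_add, Complex.ofReal_mul, mul_inv, Complex.ofReal_inv, mul_assoc]
  -- The value prescribed at an element of s' does not depend on the step used to represent it.
  have hcons : ∀ r v r' v', SlowSeq.stepL r v = SlowSeq.stepL r' v' → r ≤ r' →
      ∀ j, (wt j r : ℂ)⁻¹ * S r v j = (wt j r' : ℂ)⁻¹ * S r' v' j := by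
    intro r v r' v' h hr j
    obtain ⟨d, rfl⟩ := Nat.exists_eq_add_of_le hr
    rw [← stepL_invWeight r d] at h
    rw [hstep r d, SlowSeq.stepL_injective _ h]
  have hrep : ∀ η : SlowSeq, ∃ r v, SlowSeq.stepL r v = η := fun η => by
    obtain ⟨r, hr⟩ := SlowSeq.exists_stepL η
    exact ⟨r, hr r le_rfl⟩
  choose ρ ν hν using hrep
  obtain ⟨g, hg⟩ : ∃ g : SlowSeq → ℕ → ℂ,
      ∀ r v j, (wt j r : ℂ) * g (SlowSeq.stepL r v) j = S r v j := by
    refine ⟨fun η j => (wt j (ρ η) : ℂ)⁻¹ * S (ρ η) (ν η) j, fun r v j => ?_⟩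
    rw [mul_comm, ← eq_mul_inv_iff_mul_eq₀ (wt_ne j r), mul_comm (S r v j)]
    rcases le_total (ρ (SlowSeq.stepL r v)) r with h | h
    · exact hcons _ _ _ _ (hν _) h j
    · exact (hcons _ _ _ _ (hν _).symm h j).symm
  have hmono : ∀ (η : SlowSeq) {q m : ℕ}, q ≤ m → ∀ j,
      ‖(wt j q : ℂ) * g η j‖ ≤ ‖(wt j m : ℂ) * g η j‖ := by
    intro η q m h j
    rw [norm_mul, norm_mul]
    gcongr
    simp only [Complex.norm_real, Real.norm_eq_abs, abs_of_pos (wt_pos _ _)]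
    exact wt_mono j h
  have hmem : ∀ η, g η ∈ koethe 2 wt := by
    intro η q
    obtain ⟨p, hp⟩ := SlowSeq.exists_stepL η
    -- Each element lies in all later steps; one of index at least `q` also controls the `q`-th
    -- weight of the image.
    obtain ⟨v, rfl⟩ := hp (max p q) (le_max_left _ _)
    refine (lp.memℓp (S (max p q) v)).mono' fun j => ?_
    rw [← hg]
    exact hmono _ (le_max_right _ _) j
  let G : SlowSeq →ₗ[ℂ] RapidSeq :=
    { toFun := fun η => ⟨g η, hmem η⟩
      map_add' := by
        intro ξ η
        obtain ⟨p, hp⟩ := SlowSeq.exists_stepL ξ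
        obtain ⟨p', hp'⟩ := SlowSeq.exists_stepL η
        obtain ⟨v, rfl⟩ := hp (max p p') (le_max_left _ _)
        obtain ⟨w, rfl⟩ := hp' (max p p') (le_max_right _ _)
        ext j
        refine mul_left_cancel₀ (wt_ne j (max p p')) ?_
        change _ * g _ j = _ * (g _ j + g _ j)
        rw [← map_add, mul_add, hg, hg, hg, map_add]
        rfl
      map_smul' := by
        intro c η
        obtain ⟨p, hp⟩ := SlowSeq.exists_stepL η
        obtain ⟨v, rfl⟩ := hp p le_rfl
        ext j
        refine mul_left_cancel₀ (wt_ne j p) ?_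
        change _ * g _ j = _ * (c * g _ j)
        rw [← map_smul, mul_left_comm, hg, hg, map_smul]
        rfl }
  have hbound : ∀ q p, ∃ C : ℝ, ∀ v,
      KoetheSpace.seminorm 2 wt q (G (SlowSeq.step p v)) ≤ C * ‖v‖ := by
    intro q p
    refine ⟨‖S (p + q)‖, fun v => ?_⟩
    have h1 : KoetheSpace.seminorm 2 wt q (G (SlowSeq.step p v)) ≤
        ‖S (p + q) (invWeight q v)‖ := by
      rw [KoetheSpace.seminorm_apply]
      refine lp.norm_mono (by simp) fun j => ?_
      rw [← hg, stepL_invWeight]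
      exact hmono (SlowSeq.stepL p v) (Nat.le_add_left q p) j
    refine h1.trans ((ContinuousLinearMap.le_opNorm _ _).trans ?_)
    gcongr
    have h2 := (invWeight q).le_of_opNorm_le (norm_invWeight_le q) v
    rwa [one_mul] at h2
  let y : SmoothOp :=
    { toLinearMap := G
      cont := by
        refine WithSeminorms.continuous_of_isBounded SlowSeq.withSeminorms
          (KoetheSpace.withSeminorms 2 wt) _ ?_
        intro q
        -- A seminorm of s pulled back along `G` is bounded on each step, hence is itself one of the
        -- seminorms defining the inductive limit topology.
        let Q : SlowSeq.IndSeminorm :=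
          ⟨(KoetheSpace.seminorm 2 wt q).comp G, fun p => hbound q p⟩
        have hQ : (KoetheSpace.seminorm 2 wt q).comp G = SlowSeq.seminorm Q := rfl
        exact ⟨{Q}, 1, by rw [one_smul, Finset.sup_singleton, hQ]⟩ }
  refine ⟨y, fun q => ?_⟩
  ext1 v
  apply lp.ext; funext j
  exact hg q v j

theorem tendsto_iff_weighted {ι : Type*} {l : Filter ι} {u : ι → SmoothOp} {x : SmoothOp} :
    Tendsto u l (𝓝 x) ↔ ∀ q, Tendsto (fun i => weighted q (u i)) l (𝓝 (weighted q x)) := by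
  rw [withSeminorms.tendsto_nhds]
  refine forall_congr' fun q => ?_
  rw [Metric.tendsto_nhds]
  simp only [dist_eq_norm, ← map_sub, ← opNorm_apply]

theorem tendsto_iff_opNorm {ι : Type*} {l : Filter ι} {u : ι → SmoothOp} {x : SmoothOp} :
    Tendsto u l (𝓝 x) ↔ ∀ q, Tendsto (fun i => opNorm q (u i - x)) l (𝓝 0) := by
  rw [tendsto_iff_weighted]
  refine forall_congr' fun q => ?_
  rw [tendsto_iff_norm_sub_tendsto_zero]
  simp only [← map_sub, ← opNorm_apply]

theorem continuous_weighted (q : ℕ) : Continuous (weighted q) :=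
  continuous_iff_continuousAt.mpr fun x => tendsto_iff_weighted.mp (tendsto_id (x := 𝓝 x)) q

instance : T2Space SmoothOp :=
  T2Space.of_injective_continuous (weighted_injective 0) (continuous_weighted 0)

/-- `L(s', s)` is sequentially complete. -/
theorem exists_tendsto {u : ℕ → SmoothOp}
    (hu : ∀ q, ∃ T, Tendsto (fun n => weighted q (u n)) atTop (𝓝 T)) :
    ∃ x, Tendsto u atTop (𝓝 x) := by
  choose S hS using hu
  obtain ⟨x, hx⟩ := exists_weighted_eq S fun p r => by
    refine tendsto_nhds_unique (hS p) ?_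
    simp only [fun n => weighted_add p r (u n)]
    exact ((hS (p + r)).const_mul (invWeight r)).mul_const (invWeight r)
  exact ⟨x, tendsto_iff_weighted.mpr fun q => hx q ▸ hS q⟩

/-- Absolutely convergent series converge in `L(s', s)`. -/
theorem exists_hasSum {ι : Type*} {u : ι → SmoothOp}
    (hu : ∀ q, Summable fun n => opNorm q (u n)) : ∃ x, HasSum u x := by
  have h1 : ∀ q, Summable fun n => weighted q (u n) := fun q => Summable.of_norm (hu q)
  obtain ⟨x, hx⟩ := exists_weighted_eq (fun q => ∑' n, weighted q (u n)) fun p r => by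
    rw [← (h1 (p + r)).tsum_mul_left, ← ((h1 (p + r)).mul_left _).tsum_mul_right]
    exact tsum_congr fun n => weighted_add p r (u n)
  refine ⟨x, tendsto_iff_weighted.mpr fun q => ?_⟩
  rw [hx q]
  simp only [map_sum]
  exact (h1 q).hasSum

theorem opNorm_le_tsum {ι : Type*} {u : ι → SmoothOp} {x : SmoothOp} (hx : HasSum u x) {q : ℕ}
    (hu : Summable fun n => opNorm q (u n)) : opNorm q x ≤ ∑' n, opNorm q (u n) := by
  have h1 : HasSum (fun n => weighted q (u n)) (weighted q x) :=
    hx.map (weighted q) (continuous_weighted q)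
  rw [opNorm_apply, ← h1.tsum_eq]
  exact norm_tsum_le_tsum_norm hu

end SmoothOp

/-! ### Spectral and minimal projections in A -/

open SmoothOp

variable {A : NonUnitalStarSubalgebra ℂ SmoothOp}

/-- A closed `*`-subalgebra contains a nonzero spectral projection of `y* y` for each of its
elements `y ≠ 0`. -/
theorem exists_spectral_projection (hA : IsClosed (A : Set SmoothOp)) {y : SmoothOp} (hy : y ∈ A)
    (hy0 : y ≠ 0) :
    ∃ E ∈ projections A, ∃ r : ℂ, r ≠ 0 ∧ star y * y * E = r • E := by
  have hn : ‖toL2 y‖ ≠ 0 := by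
    rw [norm_ne_zero_iff]
    exact fun h => hy0 (toL2_injective (by rw [h, map_zero]))
  -- Scaling by `c` makes the operator norm of `z` equal to one, as the convergence of powers
  -- requires.
  let c : ℂ := ((‖toL2 y‖⁻¹ : ℝ) : ℂ)
  have hc : c ≠ 0 := by simpa [c] using hn
  let z : SmoothOp := star (c • y) * (c • y)
  have hz : z ∈ A := mul_mem (star_mem (SMulMemClass.smul_mem c hy)) (SMulMemClass.smul_mem c hy)
  have hzT : toL2 z = star (toL2 (c • y)) * toL2 (c • y) := by
    rw [toL2_mul, toL2_star, ContinuousLinearMap.star_eq_adjoint]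
  have hz1 : ‖toL2 z‖ = 1 := by
    have h1 := CStarRing.norm_star_mul_self (x := toL2 (c • y))
    rw [← hzT] at h1
    rw [h1, map_smul, norm_smul, Complex.norm_real, norm_inv,
      norm_norm, inv_mul_cancel₀ hn, one_mul]
  obtain ⟨E, hE, hE0, hzE, hlim⟩ := (isCompactOperator_toL2 z).exists_tendsto_pow
    (by rw [hzT]; exact star_mul_self_nonneg _) hz1
  -- There is no unit to start from, so `u n` is the power of `z` with exponent n + 1.
  let u : ℕ → SmoothOp := fun n => (fun w => w * z)^[n] z
  have hus : ∀ n, u (n + 1) = u n * z := fun n => Function.iterate_succ_apply' _ _ _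
  have huA : ∀ n, u n ∈ A := by
    intro n
    induction n with
    | zero => exact hz
    | succ n ih => rw [hus]; exact mul_mem ih hz
  have huT : ∀ n, toL2 (u n) = toL2 z ^ (n + 1) := by
    intro n
    induction n with
    | zero => rw [zero_add, pow_one]; rfl
    | succ n ih => rw [hus, toL2_mul, ih, pow_succ _ (n + 1)]
  -- The outer factors `z` absorb the weights, so operator-norm convergence of the middle factor
  -- suffices for every ‖·‖_q.
  obtain ⟨e, he⟩ := exists_tendsto (u := fun n => z * u n * z) fun q => by
    refine ⟨left q z * E * right q z, ?_⟩
    simp only [weighted_mul_mul, huT]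
    exact (((tendsto_add_atTop_iff_nat 1).mpr hlim).const_mul _).mul_const _
  have heT : toL2 e = E := by
    refine tendsto_nhds_unique (tendsto_iff_weighted.mp he 0)
      (((tendsto_add_atTop_iff_nat 3).mpr hlim).congr fun n => ?_)
    change _ = toL2 (z * u n * z)
    have h1 : toL2 (z * u n * z) = toL2 z * toL2 (u n) * toL2 z := rfl
    rw [h1, huT, ← pow_succ', ← pow_succ]
  have heA : e ∈ A :=
    hA.mem_of_tendsto he (Eventually.of_forall fun n => mul_mem (mul_mem hz (huA n)) hz)
  have hze : z * e = e := toL2_injective (by rw [toL2_mul, heT, hzE])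
  refine ⟨e, ⟨heA, by rw [IsProj, heT]; exact hE, ?_⟩, (star c * c)⁻¹,
    inv_ne_zero (mul_ne_zero (star_ne_zero.mpr hc) hc), ?_⟩
  · rintro rfl
    exact hE0 (by rw [← heT, map_zero])
  · rw [eq_inv_smul_iff₀ (mul_ne_zero (star_ne_zero.mpr hc) hc), ← smul_mul_assoc]
    conv_rhs => rw [← hze]
    congr 1
    change _ = star (c • y) * (c • y)
    rw [star_smul, smul_mul_smul_comm]

theorem projections_mul_comm (hcomm : ∀ x ∈ A, ∀ y ∈ A, x * y = y * x) {P Q : SmoothOp}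
    (hP : P ∈ projections A) (hQ : Q ∈ projections A) : (P * Q).IsProj := by
  have h := hcomm P hP.1 Q hQ.1
  refine IsProj.of_star_of_mul ?_ ?_
  · rw [star_mul, hP.2.1.star_eq, hQ.2.1.star_eq, h]
  · calc P * Q * (P * Q) = P * (Q * P) * Q := by simp only [mul_assoc]
      _ = (P * P) * (Q * Q) := by rw [← h]; simp only [mul_assoc]
      _ = P * Q := by rw [hP.2.1.mul_self, hQ.2.1.mul_self]

theorem minimalProjections_eq_of_mul_eq (hcomm : ∀ x ∈ A, ∀ y ∈ A, x * y = y * x) {P Q : SmoothOp}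
    (hP : P ∈ minimalProjections A) (hQ : Q ∈ projections A) (h : P * Q = Q) : Q = P :=
  hP.2 Q hQ ⟨by rw [hcomm Q hQ.1 P hP.1.1, h], h⟩

/-- If nonzero, the product would be a projection in A below both, so equal to both by minimality.
-/
theorem minimalProjections_orthogonal (hcomm : ∀ x ∈ A, ∀ y ∈ A, x * y = y * x) {P Q : SmoothOp}
    (hP : P ∈ minimalProjections A) (hQ : Q ∈ minimalProjections A) (hne : P ≠ Q) :
    P * Q = 0 := by
  by_contra h0
  have hPQ : P * Q ∈ projections A :=
    ⟨mul_mem hP.1.1 hQ.1.1, projections_mul_comm hcomm hP.1 hQ.1, h0⟩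
  have h1 := minimalProjections_eq_of_mul_eq hcomm hP hPQ
    (by rw [← mul_assoc, hP.1.2.1.mul_self])
  have h2 := minimalProjections_eq_of_mul_eq hcomm hQ hPQ
    (by rw [hcomm P hP.1.1 Q hQ.1.1, ← mul_assoc, hQ.1.2.1.mul_self])
  exact hne (h1.symm.trans h2)

/-- Each nonzero projection in `A` dominates a minimal one. -/
theorem exists_minimalProjections_mul_eq {Q : SmoothOp} (hQ : Q ∈ projections A) : ∃ P ∈ minimalProjections A, Q * P = P := by
  -- Ranks are finite, so a projection of least rank below `Q` exists; anything below it has the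
  -- same range and hence coincides with it.
  let rk : SmoothOp → ℕ := fun P => Module.finrank ℂ (LinearMap.range (toL2 P).toLinearMap)
  let D : Set SmoothOp := {P | P ∈ projections A ∧ Q * P = P}
  obtain ⟨P, ⟨hP, hQP⟩, hmin⟩ :=
    exists_minimalFor_of_wellFoundedLT (· ∈ D) rk ⟨Q, hQ, hQ.2.1.mul_self⟩
  refine ⟨P, ⟨hP, ?_⟩, hQP⟩
  rintro R hR ⟨hRP, hPR⟩
  have hRD : R ∈ D := ⟨hR, by rw [← hPR, ← mul_assoc, hQP]⟩
  have hle : LinearMap.range (toL2 R).toLinearMap ≤ LinearMap.range (toL2 P).toLinearMap := by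
    rintro _ ⟨v, rfl⟩
    exact ⟨toL2 R v, by
      change (toL2 P * toL2 R) v = toL2 R v
      rw [← toL2_mul, hPR]⟩
  have hfin : FiniteDimensional ℂ (LinearMap.range (toL2 P).toLinearMap) := hP.2.1.isFinDim
  have hrk : rk P ≤ rk R := by
    rcases le_total (rk R) (rk P) with h | h
    · exact hmin hRD h
    · exact h
  have heq := Submodule.eq_of_le_of_finrank_le hle hrk
  have hRP' : R * P = P := by
    apply toL2_injective
    ext1 v
    obtain ⟨w, hw⟩ : toL2 P v ∈ LinearMap.range (toL2 R).toLinearMap := heq ▸ ⟨v, rfl⟩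
    have hw' : toL2 R w = toL2 P v := hw
    change toL2 R (toL2 P v) = toL2 P v
    rw [← hw']
    change toL2 (R * R) w = toL2 R w
    rw [hR.2.1.mul_self]
  rw [← hRP, hRP']

/-- If yP ≠ 0, then (yP)*(yP) = y*yP has an eigenprojection E in A with eigenvalue r ≠ 0. Dividing
by r shows PE = E, so E = P by minimality. -/
theorem exists_star_mul_self_mul_eq_smul (hA : IsClosed (A : Set SmoothOp))
    (hcomm : ∀ x ∈ A, ∀ y ∈ A, x * y = y * x) {P : SmoothOp} (hP : P ∈ minimalProjections A)
    {y : SmoothOp} (hy : y ∈ A) : ∃ c : ℂ, star y * y * P = c • P := by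
  have hPs := hP.1.2.1.star_eq
  have hPP := hP.1.2.1.mul_self
  have hw : star (y * P) * (y * P) = star y * y * P := by
    rw [star_mul, hPs, ← mul_assoc, mul_assoc P, hcomm P hP.1.1 _ (mul_mem (star_mem hy) hy),
      mul_assoc, hPP]
  rcases eq_or_ne (y * P) 0 with h0 | h0
  · exact ⟨0, by rw [← hw, h0, mul_zero, zero_smul]⟩
  obtain ⟨E, hE, r, hr, hEr⟩ := exists_spectral_projection hA (mul_mem hy hP.1.1) h0
  rw [hw] at hEr
  have hPE : P * E = E := by
    rw [← inv_smul_smul₀ hr E, ← hEr, mul_smul_comm, ← mul_assoc, ← mul_assoc,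
      hcomm P hP.1.1 _ (mul_mem (star_mem hy) hy), mul_assoc _ P P, hPP]
  rw [minimalProjections_eq_of_mul_eq hcomm hP hE hPE, mul_assoc _ P P, hPP] at hEr
  exact ⟨r, hEr⟩

/-- `A` acts by scalars on its minimal projections. -/
theorem exists_mul_eq_smul (hA : IsClosed (A : Set SmoothOp))
    (hcomm : ∀ x ∈ A, ∀ y ∈ A, x * y = y * x) {P : SmoothOp} (hP : P ∈ minimalProjections A)
    {y : SmoothOp} (hy : y ∈ A) : ∃ c : ℂ, y * P = c • P := by
  have hPs := hP.1.2.1.star_eq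
  have hPP := hP.1.2.1.mul_self
  -- Polarisation: the previous lemma at c = 0, 1, i gives linear equations for y*P and yP.
  have key : ∀ c : ℂ, star (y + c • P) * (y + c • P) * P =
      star y * y * P + c • (star y * P) + star c • (y * P) + (star c * c) • P := by
    intro c
    rw [star_add, star_smul, hPs]
    simp only [add_mul, mul_add, smul_mul_assoc, mul_smul_comm, mul_assoc, hPP, smul_add, smul_smul]
    rw [hcomm P hP.1.1 (y * P) (mul_mem hy hP.1.1), mul_assoc, hPP, mul_comm c]
    abel
  obtain ⟨a, ha⟩ := exists_star_mul_self_mul_eq_smul hA hcomm hP hy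
  obtain ⟨b, hb⟩ := exists_star_mul_self_mul_eq_smul hA hcomm hP
    (add_mem hy (SMulMemClass.smul_mem (1 : ℂ) hP.1.1))
  obtain ⟨d, hd⟩ := exists_star_mul_self_mul_eq_smul hA hcomm hP
    (add_mem hy (SMulMemClass.smul_mem Complex.I hP.1.1))
  rw [key, ha] at hb hd
  -- Here (b-a-1)P = y*P + yP and i(d-a-1)P = -y*P + yP, so half the sum is yP.
  refine ⟨((b - a - 1) + Complex.I * (d - a - 1)) / 2, ?_⟩
  have h1 : y * P = (1 / 2 : ℂ) • ((b • P - a • P - P) + Complex.I • (d • P - a • P - P)) := by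
    rw [← hb, ← hd]
    simp only [star_one, one_mul, one_smul, Complex.star_def, Complex.conj_I]
    have hI : -Complex.I * Complex.I = 1 := by rw [neg_mul, Complex.I_mul_I, neg_neg]
    rw [hI]
    match_scalars <;> first
      | linear_combination (1 / 2 : ℂ) * Complex.I_mul_I
      | linear_combination (-1 / 2 : ℂ) * Complex.I_mul_I
      | linear_combination
  rw [h1]
  module

/-- An element of `A` that is annihilated by the minimal projections of `A` vanishes. -/
theorem eq_zero_of_forall_mul_eq_zero (hA : IsClosed (A : Set SmoothOp)) {y : SmoothOp} (hy : y ∈ A)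
    (h : ∀ P ∈ minimalProjections A, y * P = 0) : y = 0 := by
  by_contra hy0
  obtain ⟨E, hE, r, hr, hEr⟩ := exists_spectral_projection hA hy hy0
  obtain ⟨P, hP, hEP⟩ := exists_minimalProjections_mul_eq hE
  have h1 : r • P = 0 := by
    rw [← hEP, ← smul_mul_assoc, ← hEr, mul_assoc _ E, hEP, mul_assoc, h P hP, mul_zero]
  exact hP.1.2.2 ((smul_eq_zero.mp h1).resolve_left hr)

/-! ### Nuclear Köthe matrices: λ¹ = λ^∞ -/

namespace KoetheSpace

variable {a : ℕ → ℕ → ℝ}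

theorem memℓp_one_iff {f : ℕ → ℂ} : Memℓp f 1 ↔ Summable fun n => ‖f n‖ := by
  rw [memℓp_gen_iff (by simp)]
  simp

theorem seminorm_one_apply (q : ℕ) (ξ : KoetheSpace 1 a) :
    seminorm 1 a q ξ = ∑' n, ‖(a n q : ℂ) * ξ n‖ := by
  rw [seminorm_apply, lp.norm_eq_tsum_rpow (by simp)]
  simp

theorem norm_mul_le_seminorm_top (q : ℕ) (ξ : KoetheSpace ⊤ a) (n : ℕ) :
    ‖(a n q : ℂ) * ξ n‖ ≤ seminorm ⊤ a q ξ :=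
  lp.norm_apply_le_norm (by simp) (weight ⊤ a q ξ) n

theorem seminorm_top_le_one (q : ℕ) (ξ : KoetheSpace 1 a) (η : KoetheSpace ⊤ a)
    (h : ∀ n, η n = ξ n) : seminorm ⊤ a q η ≤ seminorm 1 a q ξ := by
  refine lp.norm_le_of_forall_le (apply_nonneg _ _) fun n => ?_
  rw [weight_apply, h]
  exact lp.norm_apply_le_norm (by simp) (weight 1 a q ξ) n

/-- The Grothendieck–Pietsch condition, in a uniform form. -/
structure Nuclear (a : ℕ → ℕ → ℝ) (ω : ℕ → ℝ) (ρ : ℕ → ℕ) : Prop where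
  nonneg : ∀ n q, 0 ≤ a n q
  summable : Summable ω
  weight_nonneg : ∀ n, 0 ≤ ω n
  le : ∀ n q, a n q ≤ ω n * a n (ρ q)

namespace Nuclear

variable {ω : ℕ → ℝ} {ρ : ℕ → ℕ}

theorem norm_le (h : Nuclear a ω ρ) {ξ : ℕ → ℂ} {q : ℕ} {B : ℝ}
    (hB : ∀ n, ‖(a n (ρ q) : ℂ) * ξ n‖ ≤ B) (n : ℕ) :
    ‖(a n q : ℂ) * ξ n‖ ≤ ω n * B := by
  have := hB n
  rw [norm_mul, Complex.norm_real, Real.norm_of_nonneg (h.nonneg _ _)] at this ⊢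
  calc a n q * ‖ξ n‖ ≤ ω n * a n (ρ q) * ‖ξ n‖ := by gcongr; exact h.le n q
    _ = ω n * (a n (ρ q) * ‖ξ n‖) := mul_assoc _ _ _
    _ ≤ ω n * B := mul_le_mul_of_nonneg_left this (h.weight_nonneg n)

theorem mem_koethe_one (h : Nuclear a ω ρ) {ξ : ℕ → ℂ} {B : ℕ → ℝ}
    (hB : ∀ q n, ‖(a n q : ℂ) * ξ n‖ ≤ B q) : ξ ∈ koethe 1 a := fun q =>
  memℓp_one_iff.mpr
    (Summable.of_nonneg_of_le (fun _ => norm_nonneg _) (h.norm_le (hB (ρ q)))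
      (h.summable.mul_right _))

theorem seminorm_one_le (h : Nuclear a ω ρ) {ξ : KoetheSpace 1 a} {q : ℕ} {B : ℝ}
    (hB : ∀ n, ‖(a n (ρ q) : ℂ) * ξ n‖ ≤ B) : seminorm 1 a q ξ ≤ (∑' n, ω n) * B := by
  rw [seminorm_one_apply, ← tsum_mul_right]
  exact (memℓp_one_iff.mp (ξ.2 q)).tsum_le_tsum (h.norm_le hB) (h.summable.mul_right _)

/-- For a nuclear Köthe matrix, `λ¹(a) = λ^∞(a)` as topological vector spaces. -/
def oneEquivTop (h : Nuclear a ω ρ) : KoetheSpace 1 a ≃L[ℂ] KoetheSpace ⊤ a where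
  toFun ξ := ⟨ξ.1, fun q => (ξ.2 q).of_exponent_ge le_top⟩
  invFun η := ⟨η.1, h.mem_koethe_one fun q n => norm_mul_le_seminorm_top q η n⟩
  map_add' _ _ := rfl
  map_smul' _ _ := rfl
  left_inv _ := rfl
  right_inv _ := rfl
  continuous_toFun := by
    let f : KoetheSpace 1 a →ₗ[ℂ] KoetheSpace ⊤ a :=
      { toFun := fun ξ => ⟨ξ.1, fun q => (ξ.2 q).of_exponent_ge le_top⟩
        map_add' := fun _ _ => rfl
        map_smul' := fun _ _ => rfl }
    refine WithSeminorms.continuous_of_isBounded (withSeminorms 1 a) (withSeminorms ⊤ a) f ?_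
    intro q
    refine ⟨{q}, 1, fun ξ => ?_⟩
    rw [one_smul, Finset.sup_singleton]
    exact seminorm_top_le_one q ξ (f ξ) fun _ => rfl
  continuous_invFun := by
    let f : KoetheSpace ⊤ a →ₗ[ℂ] KoetheSpace 1 a :=
      { toFun := fun η => ⟨η.1, h.mem_koethe_one fun q n => norm_mul_le_seminorm_top q η n⟩
        map_add' := fun _ _ => rfl
        map_smul' := fun _ _ => rfl }
    refine WithSeminorms.continuous_of_isBounded (withSeminorms ⊤ a) (withSeminorms 1 a) f ?_
    intro q
    refine ⟨{ρ q}, ⟨∑' n, ω n, tsum_nonneg h.weight_nonneg⟩, fun ξ => ?_⟩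
    rw [Finset.sup_singleton]
    exact h.seminorm_one_le (ξ := f ξ) fun n => norm_mul_le_seminorm_top (ρ q) ξ n

end Nuclear

end KoetheSpace

/-! ### Coordinates with respect to the minimal projections -/

/-- The seminorms `‖·‖_q` on a subalgebra of `L(s', s)`. -/
def subNorm (A : NonUnitalStarSubalgebra ℂ SmoothOp) : SeminormFamily ℂ A ℕ :=
  opNorm.comp ({ toFun := fun x => (x : SmoothOp)
                 map_add' := fun _ _ => rfl
                 map_smul' := fun _ _ => rfl } : A →ₗ[ℂ] SmoothOp)

theorem withSeminorms_subNorm : WithSeminorms (subNorm A) :=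
  Topology.IsInducing.withSeminorms SmoothOp.withSeminorms Topology.IsInducing.subtypeVal

instance : T2Space A := inferInstanceAs (T2Space (A : Set SmoothOp))

/-- The functionals `c_n` give the coefficients of the elements of `A` with respect to a complete
system of orthogonal projections `P_n`. -/
structure IsCoordSystem (P : ℕ → A) (c : ℕ → A →ₗ[ℂ] ℂ) : Prop where
  proj : ∀ n, (P n : SmoothOp).IsProj
  ne_zero : ∀ n, (P n : SmoothOp) ≠ 0
  orthogonal : ∀ m n, m ≠ n → P m * P n = 0
  mul_eq : ∀ n x, x * P n = c n x • P n
  separating : ∀ x, (∀ n, c n x = 0) → x = 0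

/-- The Köthe matrix `(‖P_n‖_q)`. -/
abbrev opNormMatrix (P : ℕ → A) : ℕ → ℕ → ℝ := fun n q => opNorm q (P n)

namespace IsCoordSystem

variable {P : ℕ → A} {c : ℕ → A →ₗ[ℂ] ℂ}

theorem basis_ne_zero (h : IsCoordSystem P c) (n : ℕ) : P n ≠ 0 := fun h0 =>
  h.ne_zero n (by rw [h0]; rfl)

theorem coord_eq_of_mul (h : IsCoordSystem P c) {n : ℕ} {x : A} {d : ℂ} (hd : x * P n = d • P n) :
    c n x = d := by
  rw [h.mul_eq] at hd
  exact smul_left_injective ℂ (h.basis_ne_zero n) hd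

theorem coord_mul (h : IsCoordSystem P c) (n : ℕ) (x y : A) : c n (x * y) = c n x * c n y :=
  h.coord_eq_of_mul (by
    rw [mul_assoc, h.mul_eq, mul_smul_comm, h.mul_eq, smul_smul, mul_comm])

theorem basis_mul_self (h : IsCoordSystem P c) (n : ℕ) : P n * P n = P n :=
  Subtype.ext (h.proj n).mul_self

theorem coord_basis (h : IsCoordSystem P c) (m n : ℕ) : c n (P m) = if m = n then 1 else 0 := by
  split_ifs with hmn
  · subst hmn
    exact h.coord_eq_of_mul (by rw [h.basis_mul_self, one_smul])
  · exact h.coord_eq_of_mul (by rw [h.orthogonal m n hmn, zero_smul])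

theorem norm_coord_mul_le (h : IsCoordSystem P c) (n q : ℕ) (x : A) :
    ‖(opNormMatrix P n q : ℂ) * c n x‖ ≤ opNorm (2 * q) (x : SmoothOp) := by
  rw [norm_mul, Complex.norm_real, Real.norm_of_nonneg (apply_nonneg _ _), mul_comm]
  exact (h.proj n).norm_mul_opNorm_le (congrArg Subtype.val (h.mul_eq n x)) q

theorem norm_coord_le (h : IsCoordSystem P c) (n : ℕ) (x : A) :
    ‖c n x‖ ≤ opNorm 0 (x : SmoothOp) := by
  have h1 := h.norm_coord_mul_le n 0 x
  rw [norm_mul, Complex.norm_real, Real.norm_of_nonneg (apply_nonneg _ _)] at h1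
  exact (le_mul_of_one_le_left (norm_nonneg _) ((h.proj n).one_le_opNorm (h.ne_zero n) 0)).trans h1

/-- The shift q ↦ 2(q+1) comes from ‖P‖₁‖P‖_q ≤ ‖P‖_{q+1}² ≤ ‖P‖_{2(q+1)}; dividing by ‖P‖₁ ≥ 1
leaves summable weights. -/
theorem nuclear (h : IsCoordSystem P c) :
    KoetheSpace.Nuclear (opNormMatrix P) (fun n => (opNorm 1 (P n : SmoothOp))⁻¹)
      (fun q => 2 * (q + 1)) where
  nonneg _ _ := apply_nonneg _ _
  summable := summable_inv_opNorm_one h.proj h.ne_zero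
    fun m n hmn => congrArg Subtype.val (h.orthogonal m n hmn)
  weight_nonneg _ := inv_nonneg.mpr (apply_nonneg _ _)
  le n q := by
    have h1 : 0 < opNorm 1 (P n : SmoothOp) :=
      zero_lt_one.trans_le ((h.proj n).one_le_opNorm (h.ne_zero n) 1)
    rw [le_inv_mul_iff₀ h1]
    refine le_trans ?_ ((h.proj n).opNorm_sq_le (q + 1))
    rw [sq]
    gcongr
    · exact opNorm_mono (Nat.le_add_left 1 q) _
    · exact opNorm_mono (Nat.le_succ q) _

theorem coord_mem_koethe (h : IsCoordSystem P c) (x : A) :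
    (fun n => c n x) ∈ koethe 1 (opNormMatrix P) :=
  h.nuclear.mem_koethe_one fun q n => h.norm_coord_mul_le n q x

theorem opNorm_smul (ξ : ℂ) (q n : ℕ) :
    opNorm q ((ξ • P n : A) : SmoothOp) = ‖(opNormMatrix P n q : ℂ) * ξ‖ := by
  rw [norm_mul, Complex.norm_real, Real.norm_of_nonneg (apply_nonneg _ _), mul_comm]
  exact map_smul_eq_mul (opNorm q) ξ (P n : SmoothOp)

theorem summable_opNorm {ξ : ℕ → ℂ} (hξ : ξ ∈ koethe 1 (opNormMatrix P)) (q : ℕ) :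
    Summable fun n => opNorm q ((ξ n • P n : A) : SmoothOp) := by
  simp only [opNorm_smul]
  exact KoetheSpace.memℓp_one_iff.mp (hξ q)

theorem exists_hasSum (hA : IsClosed (A : Set SmoothOp)) {ξ : ℕ → ℂ}
    (hξ : ξ ∈ koethe 1 (opNormMatrix P)) : ∃ y : A, HasSum (fun n => ξ n • P n) y := by
  obtain ⟨y, hy⟩ := SmoothOp.exists_hasSum (summable_opNorm hξ)
  have hyA : y ∈ A :=
    hA.mem_of_tendsto hy (Eventually.of_forall fun F => sum_mem fun n _ => (ξ n • P n).2)
  refine ⟨⟨y, hyA⟩, Topology.IsInducing.subtypeVal.tendsto_nhds_iff.mpr ?_⟩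
  refine hy.congr fun F => ?_
  exact (map_sum (NonUnitalStarSubalgebraClass.subtype A) (fun n => ξ n • P n) F).symm

/-- The coordinates as continuous functionals. -/
def coordL (h : IsCoordSystem P c) (n : ℕ) : A →L[ℂ] ℂ where
  toLinearMap := c n
  cont := by
    refine WithSeminorms.continuous_of_isBounded withSeminorms_subNorm
      (norm_withSeminorms ℂ ℂ) (c n) fun _ => ⟨{0}, 1, fun x => ?_⟩
    rw [one_smul, Finset.sup_singleton]
    exact h.norm_coord_le n x

theorem coordL_apply (h : IsCoordSystem P c) (n : ℕ) (x : A) : h.coordL n x = c n x := rfl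

theorem coord_eq_of_hasSum (h : IsCoordSystem P c) {ξ : ℕ → ℂ} {y : A}
    (hy : HasSum (fun n => ξ n • P n) y) (n : ℕ) : c n y = ξ n := by
  have h1 := hy.mapL (h.coordL n)
  simp only [coordL_apply, map_smul, h.coord_basis, smul_eq_mul, mul_ite, mul_one, mul_zero] at h1
  refine h1.unique ?_
  convert hasSum_ite_eq n (ξ n) using 2 with m
  split_ifs with hm
  · rw [hm]
  · rfl

theorem ext_coord (h : IsCoordSystem P c) {x y : A} (hxy : ∀ n, c n x = c n y) : x = y :=
  sub_eq_zero.mp (h.separating _ fun n => by rw [map_sub, hxy, sub_self])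

/-- Absolute convergence gives a sum in A with the same coordinates as `x`; since coordinates
separate points, the sum is `x`. -/
theorem hasSum_coord (h : IsCoordSystem P c) (hA : IsClosed (A : Set SmoothOp)) (x : A) :
    HasSum (fun n => c n x • P n) x := by
  obtain ⟨y, hy⟩ := exists_hasSum hA (h.coord_mem_koethe x)
  rwa [h.ext_coord (h.coord_eq_of_hasSum hy)] at hy

theorem opNorm_le_tsum (h : IsCoordSystem P c) (hA : IsClosed (A : Set SmoothOp)) (q : ℕ) (x : A) :
    opNorm q (x : SmoothOp) ≤ ∑' n, ‖(opNormMatrix P n q : ℂ) * c n x‖ := by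
  have h1 : HasSum (fun n => ((c n x • P n : A) : SmoothOp)) x :=
    (h.hasSum_coord hA x).map (NonUnitalStarSubalgebraClass.subtype A) continuous_subtype_val
  refine (SmoothOp.opNorm_le_tsum h1 (summable_opNorm (h.coord_mem_koethe x) q)).trans_eq ?_
  exact tsum_congr fun n => opNorm_smul _ q n

theorem isSchauderBasis (h : IsCoordSystem P c) (hA : IsClosed (A : Set SmoothOp)) :
    IsSchauderBasis P := by
  refine ⟨h.coordL, fun x d => ⟨fun hd n => ?_, fun hd => ?_⟩⟩
  · refine tendsto_nhds_unique ?_ (((h.coordL n).continuous.tendsto x).comp hd)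
    refine tendsto_const_nhds.congr' ?_
    filter_upwards [eventually_gt_atTop n] with N hN
    simp only [Function.comp_apply, map_sum, map_smul, coordL_apply, h.coord_basis, smul_eq_mul,
      mul_ite, mul_one, mul_zero, Finset.sum_ite_eq', Finset.mem_range, if_pos hN]
  · have h1 := (h.hasSum_coord hA x).tendsto_sum_nat
    simpa only [hd, coordL_apply] using h1

/-- The coordinate isomorphism of `A` onto `λ¹(‖P_n‖_q)`. -/
def koetheEquiv (h : IsCoordSystem P c) (hA : IsClosed (A : Set SmoothOp)) :
    A ≃L[ℂ] KoetheSpace 1 (opNormMatrix P) :=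
  let f : A →ₗ[ℂ] KoetheSpace 1 (opNormMatrix P) :=
    { toFun := fun x => ⟨fun n => c n x, h.coord_mem_koethe x⟩
      map_add' := fun x y => KoetheSpace.ext fun n => map_add (c n) x y
      map_smul' := fun d x => KoetheSpace.ext fun n => map_smul (c n) d x }
  have hf : Function.Bijective f :=
    ⟨fun x y hxy => h.ext_coord fun n => congrArg (fun ξ => ξ n) hxy, fun ξ => by
      obtain ⟨y, hy⟩ := exists_hasSum hA ξ.2
      exact ⟨y, KoetheSpace.ext (h.coord_eq_of_hasSum hy)⟩⟩
  { LinearEquiv.ofBijective f hf with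
    continuous_toFun := by
      refine WithSeminorms.continuous_of_isBounded withSeminorms_subNorm
        (KoetheSpace.withSeminorms 1 (opNormMatrix P)) f fun q => ?_
      -- Nuclearity replaces q by 2(q+1), and the bound on the coordinates doubles the index once
      -- more.
      refine ⟨{2 * (2 * (q + 1))},
        ⟨∑' n, (opNorm 1 (P n : SmoothOp))⁻¹, tsum_nonneg h.nuclear.weight_nonneg⟩, fun x => ?_⟩
      rw [Finset.sup_singleton]
      exact h.nuclear.seminorm_one_le (ξ := f x) fun n => h.norm_coord_mul_le n _ x
    continuous_invFun := by
      refine WithSeminorms.continuous_of_isBounded (KoetheSpace.withSeminorms 1 (opNormMatrix P))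
        withSeminorms_subNorm (LinearEquiv.ofBijective f hf).symm.toLinearMap fun q => ?_
      refine ⟨{q}, 1, fun ξ => ?_⟩
      rw [one_smul, Finset.sup_singleton, KoetheSpace.seminorm_one_apply]
      obtain ⟨x, rfl⟩ := (LinearEquiv.ofBijective f hf).surjective ξ
      change opNorm q (((LinearEquiv.ofBijective f hf).symm (LinearEquiv.ofBijective f hf x) : A) :
        SmoothOp) ≤ _
      rw [LinearEquiv.symm_apply_apply]
      exact h.opNorm_le_tsum hA q x }

end IsCoordSystem

/-! ### Enumerating the minimal projections -/

/-- The functional `c` on `A` with `x P = c(x) P`, for a minimal projection `P` of `A`. -/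
theorem exists_coord (hA : IsClosed (A : Set SmoothOp))
    (hcomm : ∀ x ∈ A, ∀ y ∈ A, x * y = y * x) {P : A} (hP : (P : SmoothOp) ∈ minimalProjections A) :
    ∃ c : A →ₗ[ℂ] ℂ, ∀ x : A, x * P = c x • P := by
  have h0 : P ≠ 0 := fun h => hP.1.2.2 (by rw [h]; rfl)
  have h1 : ∀ x : A, ∃ d : ℂ, x * P = d • P := fun x => by
    obtain ⟨d, hd⟩ := exists_mul_eq_smul hA hcomm hP x.2
    exact ⟨d, Subtype.ext hd⟩
  choose c hc using h1
  have huniq : ∀ {x : A} {d : ℂ}, x * P = d • P → c x = d := fun {x d} hd =>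
    smul_left_injective ℂ h0 ((hc x).symm.trans hd)
  exact ⟨{ toFun := c
           map_add' := fun x y => huniq (by rw [add_mul, hc, hc, add_smul])
           map_smul' := fun d x => huniq (by
            rw [smul_mul_assoc, hc, smul_smul, RingHom.id_apply, smul_eq_mul]) }, hc⟩

theorem exists_isCoordSystem (hA : IsClosed (A : Set SmoothOp))
    (hcomm : ∀ x ∈ A, ∀ y ∈ A, x * y = y * x) {P : ℕ → A} (hinj : Function.Injective P)
    (hrange : (Set.range fun n => (P n : SmoothOp)) = minimalProjections A) :
    ∃ c, IsCoordSystem P c := by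
  have hP : ∀ n, (P n : SmoothOp) ∈ minimalProjections A := fun n => hrange ▸ ⟨n, rfl⟩
  choose c hc using fun n => exists_coord hA hcomm (hP n)
  refine ⟨c, fun n => (hP n).1.2.1, fun n => (hP n).1.2.2, fun m n hmn => Subtype.ext ?_, hc,
    fun x hx => Subtype.ext (eq_zero_of_forall_mul_eq_zero hA x.2 fun Q hQ => ?_)⟩
  · exact minimalProjections_orthogonal hcomm (hP m) (hP n)
      fun h => hmn (hinj (Subtype.ext h))
  · rw [← hrange] at hQ
    obtain ⟨n, rfl⟩ := hQ
    have h1 := hc n x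
    rw [hx, zero_smul] at h1
    exact congrArg Subtype.val h1

/-- The reciprocals 1/‖Q‖₁ form a summable family of nonzero terms, and a summable family has
countable support. -/
theorem countable_minimalProjections (hcomm : ∀ x ∈ A, ∀ y ∈ A, x * y = y * x) :
    Countable (minimalProjections (A : Set SmoothOp)) := by
  have h := summable_inv_opNorm_one (P := fun Q : minimalProjections (A : Set SmoothOp) => Q.1)
    (fun Q => Q.2.1.2.1) (fun Q => Q.2.1.2.2)
    fun Q R hQR => minimalProjections_orthogonal hcomm Q.2 R.2 fun h => hQR (Subtype.ext h)
  have h1 := h.countable_support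
  have h2 : Function.support (fun Q : minimalProjections (A : Set SmoothOp) =>
      (opNorm 1 Q.1)⁻¹) = Set.univ := by
    refine Set.eq_univ_of_forall fun Q => ?_
    exact inv_ne_zero (zero_lt_one.trans_le (Q.2.1.2.1.one_le_opNorm Q.2.1.2.2 1)).ne'
  rw [h2] at h1
  exact Set.countable_univ_iff.mp h1

/-- The coordinates are jointly injective, so finitely many of them would make A finite dimensional.
-/
theorem infinite_minimalProjections (hA : IsClosed (A : Set SmoothOp))
    (hcomm : ∀ x ∈ A, ∀ y ∈ A, x * y = y * x) (hinf : ¬ FiniteDimensional ℂ A) :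
    Infinite (minimalProjections (A : Set SmoothOp)) := by
  by_contra hfin
  rw [not_infinite_iff_finite] at hfin
  choose c hc using fun Q : minimalProjections (A : Set SmoothOp) =>
    exists_coord hA hcomm (P := ⟨Q.1, Q.2.1.1⟩) Q.2
  refine hinf (FiniteDimensional.of_injective (LinearMap.pi c) ?_)
  rw [← LinearMap.ker_eq_bot, LinearMap.ker_eq_bot']
  refine fun x hx => Subtype.ext (eq_zero_of_forall_mul_eq_zero hA x.2 fun Q hQ => ?_)
  have h1 := hc ⟨Q, hQ⟩ x
  have h2 : c ⟨Q, hQ⟩ x = 0 := congrFun hx ⟨Q, hQ⟩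
  rw [h2, zero_smul] at h1
  exact congrArg Subtype.val h1

theorem exists_enumeration (hA : IsClosed (A : Set SmoothOp))
    (hcomm : ∀ x ∈ A, ∀ y ∈ A, x * y = y * x) (hinf : ¬ FiniteDimensional ℂ A) :
    ∃ P : ℕ → A, Function.Injective P ∧
      (Set.range fun n => (P n : SmoothOp)) = minimalProjections A := by
  have := countable_minimalProjections hcomm
  have := infinite_minimalProjections hA hcomm hinf
  obtain ⟨e⟩ := nonempty_equiv_of_countable (α := ℕ) (β := minimalProjections (A : Set SmoothOp))
  refine ⟨fun n => ⟨(e n).1, (e n).2.1.1⟩, fun m n h => ?_, ?_⟩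
  · exact e.injective (Subtype.ext (congrArg (fun x : A => (x : SmoothOp)) h))
  · ext Q
    constructor
    · rintro ⟨n, rfl⟩
      exact (e n).2
    · exact fun hQ => ⟨e.symm ⟨Q, hQ⟩, by simp⟩

/-! ### A single generator -/

/-- There are strictly decreasing positive sequences that decay arbitrarily fast. -/
theorem exists_strictAnti_summable (a : ℕ → ℕ → ℝ) (h0 : ∀ n q, 0 ≤ a n q)
    (hmono : ∀ n, Monotone (a n)) :
    ∃ μ : ℕ → ℝ, (∀ n, 0 < μ n) ∧ StrictAnti μ ∧ ∀ q, Summable fun n => μ n * a n q := by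
  -- Diagonal choice: `b n` dominates `a n q` once n ≥ q, and the summand 1 keeps `b` positive and
  -- strictly increasing. The factor (1/2)^n then yields summability.
  let b : ℕ → ℝ := fun n => ∑ k ∈ Finset.range (n + 1), (1 + a k k)
  have hbs : ∀ n, b (n + 1) = b n + (1 + a (n + 1) (n + 1)) := fun n => Finset.sum_range_succ _ _
  have hb1 : ∀ n, 0 < b n := fun n => Finset.sum_pos
    (fun k _ => add_pos_of_pos_of_nonneg one_pos (h0 k k)) Finset.nonempty_range_add_one
  have hba : ∀ n, a n n ≤ b n := fun n =>
    (le_add_of_nonneg_left zero_le_one).trans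
      (Finset.single_le_sum (f := fun k => 1 + a k k) (fun k _ => add_nonneg zero_le_one (h0 k k))
        (Finset.mem_range.mpr (Nat.lt_succ_self n)))
  refine ⟨fun n => (1 / 2) ^ n * (b n)⁻¹, fun n => by have := hb1 n; positivity,
    strictAnti_nat_of_succ_lt fun n => ?_, fun q => ?_⟩
  · have h1 : (1 / 2 : ℝ) ^ (n + 1) < (1 / 2) ^ n :=
      pow_lt_pow_right_of_lt_one₀ (by norm_num) (by norm_num) (Nat.lt_succ_self n)
    refine mul_lt_mul h1 ?_ (inv_pos.mpr (hb1 _)) (by positivity)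
    rw [inv_le_inv₀ (hb1 _) (hb1 _), hbs]
    linarith [h0 (n + 1) (n + 1)]
  · refine Summable.of_norm_bounded_eventually_nat summable_geometric_two ?_
    filter_upwards [eventually_ge_atTop q] with n hn
    have hbn := hb1 n
    rw [Real.norm_of_nonneg (mul_nonneg (by positivity) (h0 n q)), mul_assoc]
    refine mul_le_of_le_one_right (by positivity) ?_
    rw [inv_mul_le_one₀ hbn]
    exact (hmono n hn).trans (hba n)

namespace IsCoordSystem

variable {P : ℕ → A} {c : ℕ → A →ₗ[ℂ] ℂ}

/-- If the coordinates of `x` are positive and strictly decreasing, then the `P_n` belong to the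
closed subalgebras containing `x`. -/
theorem basis_mem_of_strictAnti (h : IsCoordSystem P c) (hA : IsClosed (A : Set SmoothOp))
    {μ : ℕ → ℝ} (hpos : ∀ n, 0 < μ n) (hanti : StrictAnti μ) {x : A}
    (hx : ∀ n, c n x = μ n) {B : NonUnitalStarSubalgebra ℂ SmoothOp}
    (hB : IsClosed (B : Set SmoothOp)) (hxB : (x : SmoothOp) ∈ B) (n : ℕ) :
    (P n : SmoothOp) ∈ B := by
  induction n using Nat.strong_induction_on with
  | _ n ih =>
  -- The coordinates of `w` are 0 before `n`, 1 at `n` and in (0, 1) after `n`, so its powers have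
  -- the coordinates of `P n` as limits.
  let w : A := ((μ n)⁻¹ : ℂ) • (x - ∑ m ∈ Finset.range n, (μ m : ℂ) • P m)
  have hwB : (w : SmoothOp) ∈ B := by
    have h1 : (w : SmoothOp) =
        ((μ n)⁻¹ : ℂ) • ((x : SmoothOp) - ∑ m ∈ Finset.range n, (μ m : ℂ) • (P m : SmoothOp)) := by
      have h2 := map_sum (NonUnitalStarSubalgebraClass.subtype A) (fun m => (μ m : ℂ) • P m)
        (Finset.range n)
      change (((μ n)⁻¹ : ℂ) • ((x : SmoothOp) -
        NonUnitalStarSubalgebraClass.subtype A (∑ m ∈ Finset.range n, (μ m : ℂ) • P m))) = _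
      rw [h2]
      rfl
    rw [h1]
    exact SMulMemClass.smul_mem _ (sub_mem hxB
      (sum_mem fun m hm => SMulMemClass.smul_mem _ (ih m (Finset.mem_range.mp hm))))
  have hwc : ∀ m, c m w = if m < n then 0 else ((μ m / μ n : ℝ) : ℂ) := by
    intro m
    simp only [w, map_smul, map_sub, map_sum, h.coord_basis, hx, smul_eq_mul, mul_ite, mul_one,
      mul_zero, Finset.sum_ite_eq', Finset.mem_range]
    split_ifs
    · simp
    · push_cast; ring
  let u : ℕ → A := fun k => (fun v => v * w)^[k] w
  have hus : ∀ k, u (k + 1) = u k * w := fun k => Function.iterate_succ_apply' _ _ _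
  have huB : ∀ k, (u k : SmoothOp) ∈ B := by
    intro k
    induction k with
    | zero => exact hwB
    | succ k ihk => rw [hus]; exact mul_mem ihk hwB
  have huc : ∀ k m, c m (u k) = c m w ^ (k + 1) := by
    intro k m
    induction k with
    | zero => rw [zero_add, pow_one]; rfl
    | succ k ihk => rw [hus, h.coord_mul, ihk, pow_succ _ (k + 1)]
  have hdc : ∀ k m, c m (u k - P n) = if m ≤ n then 0 else (((μ m / μ n) ^ (k + 1) : ℝ) : ℂ) := by
    intro k m
    rw [map_sub, huc, hwc, h.coord_basis]
    rcases lt_trichotomy m n with hm | rfl | hm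
    · rw [if_pos hm, if_neg hm.ne', if_pos hm.le]; simp
    · simp [(hpos m).ne']
    · rw [if_neg hm.not_gt, if_neg hm.ne, if_neg hm.not_ge]; simp
  have hratio : ∀ m, n < m → μ m / μ n < 1 := fun m hm =>
    (div_lt_one (hpos n)).mpr (hanti hm)
  have hratio0 : ∀ m, 0 ≤ μ m / μ n := fun m => (div_pos (hpos m) (hpos n)).le
  refine hB.mem_of_tendsto (f := fun k => (u k : SmoothOp)) (b := atTop)
    (tendsto_iff_opNorm.mpr fun q => ?_) (Eventually.of_forall huB)
  refine squeeze_zero (fun _ => apply_nonneg _ _) (fun k => h.opNorm_le_tsum hA q (u k - P n)) ?_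
  have hsum : Summable fun m => ‖(opNormMatrix P m q : ℂ) * c m w‖ :=
    KoetheSpace.memℓp_one_iff.mp (h.coord_mem_koethe w q)
  rw [show (0 : ℝ) = ∑' _ : ℕ, 0 from tsum_zero.symm]
  -- Positive powers of ratios in [0, 1) are at most the ratios themselves, so the coordinate series
  -- of `w` dominates.
  refine tendsto_tsum_of_dominated_convergence hsum (fun m => ?_)
    (Eventually.of_forall fun k m => ?_)
  · simp only [hdc]
    split_ifs with hm
    · simp
    · have h1 := ((tendsto_add_atTop_iff_nat 1).mpr (tendsto_pow_atTop_nhds_zero_of_lt_one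
        (hratio0 m) (hratio m (not_le.mp hm)))).const_mul (opNormMatrix P m q)
      rw [mul_zero] at h1
      refine h1.congr fun k => ?_
      rw [← Complex.ofReal_mul, Complex.norm_real, Real.norm_of_nonneg
        (mul_nonneg (apply_nonneg _ _) (pow_nonneg (hratio0 m) _))]
  · rw [norm_norm, norm_mul, norm_mul, hdc, hwc]
    refine mul_le_mul_of_nonneg_left ?_ (norm_nonneg _)
    split_ifs with hm hm' hm'
    · simp
    · rw [norm_zero]; exact norm_nonneg _
    · exact absurd hm'.le hm
    · rw [Complex.norm_real, Complex.norm_real, Real.norm_of_nonneg (hratio0 m),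
        Real.norm_of_nonneg (pow_nonneg (hratio0 m) _)]
      exact pow_le_of_le_one (hratio0 m) (hratio m (not_le.mp hm)).le (Nat.succ_ne_zero k)

theorem le_of_basis_mem (h : IsCoordSystem P c) (hA : IsClosed (A : Set SmoothOp))
    {B : NonUnitalStarSubalgebra ℂ SmoothOp} (hB : IsClosed (B : Set SmoothOp))
    (hP : ∀ n, (P n : SmoothOp) ∈ B) : A ≤ B := by
  intro x hx
  have h1 : HasSum (fun n => ((c n ⟨x, hx⟩ • P n : A) : SmoothOp)) x :=
    (h.hasSum_coord hA ⟨x, hx⟩).map (NonUnitalStarSubalgebraClass.subtype A) continuous_subtype_val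
  exact hB.mem_of_tendsto h1
    (Eventually.of_forall fun F => sum_mem fun n _ => SMulMemClass.smul_mem (c n ⟨x, hx⟩) (hP n))

/-- Series expansion lets the `P n` stand for all of A, so a generating set need only capture them.
It serves both for the set of all `P n` and for a single `x`. -/
theorem eq_alg (h : IsCoordSystem P c) (hA : IsClosed (A : Set SmoothOp)) {Z : Set SmoothOp}
    (hZ : Z ⊆ A) (hP : ∀ B : NonUnitalStarSubalgebra ℂ SmoothOp, IsClosed (B : Set SmoothOp) →
      Z ⊆ B → ∀ n, (P n : SmoothOp) ∈ B) : A = alg Z :=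
  le_antisymm (le_sInf fun B hB => h.le_of_basis_mem hA hB.1 (hP B hB.1 hB.2))
    (sInf_le ⟨hA, hZ⟩)

theorem exists_generator (h : IsCoordSystem P c) (hA : IsClosed (A : Set SmoothOp)) :
    ∃ x ∈ A, ∃ μ : ℕ → ℂ, IsSpectralRep x μ (fun n => (P n : SmoothOp)) ∧ A = alg {x} := by
  -- Adding `wt n q` to the matrix makes one sequence serve two ends: ∑ μ_n P_n converges
  -- absolutely, and (μ_n) lies in s.
  obtain ⟨μ, hpos, hanti, hsum⟩ := exists_strictAnti_summable
    (fun n q => opNormMatrix P n q + wt n q)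
    (fun n q => add_nonneg (apply_nonneg _ _) (wt_pos n q).le)
    (fun n p q hpq => add_le_add (opNorm_mono hpq _) (wt_mono n hpq))
  have hμ : ∀ n, ‖(μ n : ℂ)‖ = μ n := fun n => by
    rw [Complex.norm_real, Real.norm_of_nonneg (hpos n).le]
  have hmem : (fun n => (μ n : ℂ)) ∈ koethe 1 (opNormMatrix P) := fun q => by
    refine KoetheSpace.memℓp_one_iff.mpr ((hsum q).of_nonneg_of_le (fun _ => norm_nonneg _) ?_)
    intro n
    rw [norm_mul, hμ, Complex.norm_real, Real.norm_of_nonneg (apply_nonneg _ _), mul_comm]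
    exact mul_le_mul_of_nonneg_left (le_add_of_nonneg_right (wt_pos n q).le) (hpos n).le
  obtain ⟨x, hx⟩ := exists_hasSum hA hmem
  have hxc := h.coord_eq_of_hasSum hx
  refine ⟨x, x.2, fun n => μ n, ⟨?_, fun q => ?_, fun n => ?_, ?_, fun n => ?_, fun m n hmn => ?_,
    summable_opNorm hmem, ?_⟩, h.eq_alg hA (Set.singleton_subset_iff.mpr x.2) ?_⟩
  · simpa only [hμ] using hanti.antitone
  · refine Memℓp.of_exponent_ge (q := 1) (KoetheSpace.memℓp_one_iff.mpr
      ((hsum q).of_nonneg_of_le (fun _ => norm_nonneg _) fun n => ?_)) one_le_two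
    rw [norm_mul, hμ, Complex.norm_real, Real.norm_of_nonneg (wt_pos n q).le, mul_comm]
    exact mul_le_mul_of_nonneg_left (le_add_of_nonneg_left (apply_nonneg _ _)) (hpos n).le
  · exact Complex.ofReal_ne_zero.mpr (hpos n).ne'
  · exact Complex.ofReal_injective.comp hanti.injective
  · exact ⟨h.proj n, h.ne_zero n, (h.proj n).isFinDim⟩
  · exact congrArg Subtype.val (h.orthogonal m n hmn)
  · have h1 : HasSum (fun n => (((μ n : ℂ) • P n : A) : SmoothOp)) x :=
      hx.map (NonUnitalStarSubalgebraClass.subtype A) continuous_subtype_val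
    exact h1.tendsto_sum_nat
  · intro B hB hxB n
    exact h.basis_mem_of_strictAnti hA hpos hanti hxc hB (Set.singleton_subset_iff.mp hxB) n

/-- Take adjoints in xP_n = c_n(x)P_n, using that P_n is self-adjoint and commutes with x*. -/
theorem coord_star (h : IsCoordSystem P c) (hcomm : ∀ x ∈ A, ∀ y ∈ A, x * y = y * x) (n : ℕ)
    (x : A) : c n (star x) = (starRingEnd ℂ) (c n x) := by
  have hPs : star (P n) = P n := Subtype.ext (h.proj n).star_eq
  have h1 : star x * P n = P n * star x :=
    Subtype.ext (hcomm _ (star x).2 _ (P n).2)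
  refine h.coord_eq_of_mul ?_
  calc star x * P n = star (x * P n) := by rw [star_mul, hPs, h1]
    _ = (starRingEnd ℂ) (c n x) • P n := by rw [h.mul_eq, star_smul, hPs]; rfl

end IsCoordSystem

end SmoothOperators

end

/-! ### The theorem -/

open SmoothOperators
theorem mainTheorem2
    (A : NonUnitalStarSubalgebra ℂ SmoothOp)
    (hclosed : IsClosed (A : Set SmoothOp))
    (hcomm : ∀ x ∈ A, ∀ y ∈ A, x * y = y * x)
    (hinf : ¬ FiniteDimensional ℂ A) :
    -- the minimal projections of `A` can be enumerated as an infinite sequence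
    (∃ P : ℕ → A, Function.Injective P ∧
      Set.range (fun n => (P n : SmoothOp)) =
        minimalProjections A) ∧
    -- and every such enumeration has the asserted properties
    ∀ P : ℕ → A, Function.Injective P →
      Set.range (fun n => (P n : SmoothOp)) =
        minimalProjections A →
      (∀ m n, m ≠ n → P m * P n = 0) ∧
      (∀ n, (P n : SmoothOp).IsFinDim) ∧
      IsSchauderBasis P ∧
      A = alg (Set.range fun n => (P n : SmoothOp)) ∧
      -- `A` is isomorphic to `λ¹(‖P_n‖_q)` with pointwise operations, `P_n` going to the `n`-th unit
      (∃ Φ : A ≃L[ℂ] KoetheSpace 1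
          (fun n q => SmoothOp.opNorm q (P n)),
        (∀ x y n, Φ (x * y) n = Φ x n * Φ y n) ∧
        (∀ x n, Φ (star x) n = (starRingEnd ℂ) (Φ x n)) ∧
        (∀ m n, Φ (P m) n = if m = n then 1 else 0)) ∧
      -- `λ¹(‖P_n‖_q) = λ^∞(‖P_n‖_q)` as sets of sequences and as topological vector spaces
      (∃ Ψ : KoetheSpace 1
            (fun n q => SmoothOp.opNorm q (P n)) ≃L[ℂ]
          KoetheSpace ⊤
            (fun n q => SmoothOp.opNorm q (P n)),
        ∀ ξ n, Ψ ξ n = ξ n) ∧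
      -- `A` is generated by a single operator `x = ∑ μ_n P_n`
      (∃ x ∈ A, ∃ μ : ℕ → ℂ,
        IsSpectralRep x μ (fun n => (P n : SmoothOp)) ∧
        A = alg {x}) := by
  refine ⟨exists_enumeration hclosed hcomm hinf, fun P hinj hrange => ?_⟩
  obtain ⟨c, h⟩ := exists_isCoordSystem hclosed hcomm hinj hrange
  refine ⟨h.orthogonal, fun n => (h.proj n).isFinDim, h.isSchauderBasis hclosed, ?_,
    ⟨h.koetheEquiv hclosed, fun x y n => h.coord_mul n x y, fun x n => h.coord_star hcomm n x,
      fun m n => h.coord_basis m n⟩,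
    ⟨h.nuclear.oneEquivTop, fun _ _ => rfl⟩, h.exists_generator hclosed⟩
  refine h.eq_alg hclosed ?_ fun B _ hPB n => hPB ⟨n, rfl⟩
  rintro _ ⟨n, rfl⟩
  exact (P n).2
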